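/- **Setting.** Let $\phi(\cdot;\mu,v)$ be the density of $N(\mu,v)$. Parameters are $\psi=(\beta,A)\in\mathbb R^p\times(0,\infty)$ with $p\ge 1$. For an observation $(y,x,D)\in\mathbb R\times\mathbb R^p\times(0,\infty)$ and $\gamma\ge 0$ put $$w_\gamma(y,x,D;\psi)=\phi(y;x^\top\beta,A+D)^{\gamma}\{2\pi(A+D)\}^{\gamma^2/(2(1+\gamma))},$$ $$\mathcal D_\gamma(y,x,D;\psi)=\gamma^{-1}w_\gamma(y,x,D;\psi)\ (\gamma>0),\qquad \mathcal D_0(y,x,D;\psi)=\log\phi(y;x^\top\beta,A+D),$$ $$v_\gamma(y,x,D;\psi)=w_\gamma(y,x,D;\psi)\,\frac{D^2}{(A+D)^2}\left\{\gamma(y-x^\top\beta)^2-(A+D)\right\}.$$ Let $\nu$ be a probability law of $(x,D)$ on $\mathbb R^p\times\mathbb R$, let $\Psi\subset\mathbb R^p\times(0,\infty)$ be compact, $\psi_*=(\beta_*,A_*)\in\Psi$, $\omega\in(0,1/2)$, and let $\Gamma$ be a finite set with $\{0,1\}\subseteq\Gamma\subseteq[0,1]$. Let $$Q(\gamma;\psi)=E_{\psi_*}[v_\gamma(y,x,D;\psi)],\qquad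 (x,D)\sim\nu,\quad y\mid x,D\sim N(x^\top\beta_*,A_*+D).$$ For a probability density $\delta$ on $\mathbb R$, the contaminated model is: $(x_i,D_i)\sim\nu$; $\theta_i$ given $(x_i,D_i)$ has density $(1-\omega)\phi(\theta;x_i^\top\beta_*,A_*)+\omega\delta(\theta)$; $y_i\mid\theta_i,x_i,D_i\sim N(\theta_i,D_i)$; and the triples $(y_i,x_i,D_i)$, $i\ge1$, are independent and identically distributed. Let $\widehat\psi_m^{(\gamma)}\in\arg\max_{\psi\in\Psi}\sum_{i=1}^m\mathcal D_\gamma(y_i,x_i,D_i;\psi)$, and let $$\gamma_{op}\in\arg\min_{\gamma\in\Gamma}\sum_{i=1}^m\left\{D_i+v_\gamma(y_i,x_i,D_i;\widehat\psi_m^{(\gamma)})\right\}.$$ **Theorem.** Assume: * $0<D_L\le D\le D_U<\infty$ $\nu$-almost surely; * $x\in\mathcal X$ $\nu$-almost surely for a bounded set $\mathcal X\subset\mathbb R^p$; the first coordinate of $x$ equals $1$ almost surely; $E[xx^\top]$ is positive definite; and $E[xx^\top/(a+D)]$ is nonsingular for every $a>0$; * some $\gamma_*\in\Gamma\setminus\{0\}$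 satisfies $Q(0;\psi_*)>(1-\omega)\,Q(\gamma_*;\psi_*)$. Then there is $\rho_0>0$, depending on $\nu,\mathcal X,D_L,D_U,\Psi,\psi_*,\Gamma,\omega,\gamma_*$ but not on $\delta$, such that the following holds for every probability density $\delta$ on $\mathbb R$. Suppose that * $\delta$ has a finite mean $\mu_\delta$ and a finite variance; * $E[(x^\top\beta_*-\mu_\delta)^2\mid D]\ge A_*+D_U$ almost surely; * for $\gamma=\gamma_*$ and with $z=(y,x,D)$ distributed as an observation of the contaminated model: (a) $\psi\mapsto\partial_\psi\mathcal D_\gamma(z;\psi)$ is twice continuously differentiable on $\mathbb R^p\times(0,\infty)$ for every $z\in\mathbb R\times\mathcal X\times[D_L,D_U]$; (b) there is a root $\psi_\dagger\in\Psi$ of $E[\partial_\psi\mathcal D_\gamma(z;\psi)]=0$; (c) $E\|\partial_\psi\mathcal D_\gamma(z;\psi)\|^2<\infty$ for $\psi\in\Psi$; (d) $E[\partial_\psi\partial_{\psi^\top}\mathcal D_\gamma(z;\psi_\dagger)]$ exists and is nonsingular; (e) the second-order derivatives of $\psi\mapsto\partial_\psi\mathcal D_\gamma(z;\psi)$ are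 dominated, in a neighbourhood of $\psi_\dagger$, by a fixed integrable function of $z$; * with $f_{\delta,D}(y)=\int\phi(y;\theta,D)\delta(\theta)\,d\theta$, $$\rho=\max_{k\in\{0,1,2\}}\ \sup_{D\in[D_L,D_U]}\ \sup_{x\in\mathcal X}\int f_{\delta,D}(y)\,\phi(y;x^\top\beta_*,A_*+D)^{\gamma_*}\,|y-x^\top\beta_*|^k\,dy\ \le\ \rho_0 .$$ Then, under the contaminated model, $P(\gamma_{op}>0)\to1$ as $m\to\infty$. -/

import Mathlib

open MeasureTheory ProbabilityTheory Filter Topology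
open scoped ENNReal

set_option maxSynthPendingDepth 3

namespace RobustFayHerriot

noncomputable section

/-- Covariate vectors and regression coefficients: `ℝ^p`. -/
abbrev Cov (p : ℕ) := EuclideanSpace ℝ (Fin p)

/-- Parameters `ψ = (β, A)`, with `β = ψ.1` and `A = ψ.2`. -/
abbrev Param (p : ℕ) := Cov p × ℝ

/-- One observation `(y, x, D)`. -/
abbrev Obs (p : ℕ) := ℝ × Cov p × ℝ

/-- The density `φ(y; μ, v)` of the normal distribution with mean `μ` and variance `v`. -/
def phi (y μ v : ℝ) : ℝ := gaussianPDFReal μ v.toNNReal y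

/-- The weight `w_γ(y) = φ(y; xᵀβ, A + D)^γ c_γ(A)`, where
`c_γ(A) = (2π(A + D))^(γ² / (2(1 + γ)))`. -/
def weight {p : ℕ} (γ y : ℝ) (x : Cov p) (D : ℝ) (ψ : Param p) : ℝ :=
  phi y (inner ℝ x ψ.1) (ψ.2 + D) ^ γ *
    (2 * Real.pi * (ψ.2 + D)) ^ (γ ^ 2 / (2 * (1 + γ)))

/-- The contribution of one observation to the objective function: the `γ`-divergence
likelihood `γ⁻¹ φ^γ c_γ` for `γ ≠ 0`, and the marginal log-likelihood for `γ = 0`. -/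
def gammaLik {p : ℕ} (γ y : ℝ) (x : Cov p) (D : ℝ) (ψ : Param p) : ℝ :=
  if γ = 0 then Real.log (phi y (inner ℝ x ψ.1) (ψ.2 + D))
  else 1 / γ * weight γ y x D ψ

/-- `w_γ(y) D² / (A + D)² {γ (y - xᵀβ)² - (A + D)}`. -/
def varTerm {p : ℕ} (γ y : ℝ) (x : Cov p) (D : ℝ) (ψ : Param p) : ℝ :=
  weight γ y x D ψ * (D ^ 2 / (ψ.2 + D) ^ 2) *
    (γ * (y - inner ℝ x ψ.1) ^ 2 - (ψ.2 + D))

/-- The robust posterior variance `s̃²^(γ)` of one area. -/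
def robustVar {p : ℕ} (γ y : ℝ) (x : Cov p) (D : ℝ) (ψ : Param p) : ℝ :=
  D + varTerm γ y x D ψ

/-- `Q(γ; ψ)`: the expectation of `varTerm γ y x D ψ` when `(x, D) ~ ν` and
`y | x, D ~ N(xᵀβ⋆, A⋆ + D)`, where `ψ⋆ = (β⋆, A⋆)`. -/
def Q {p : ℕ} (ν : Measure (Cov p × ℝ)) (ψstar : Param p) (γ : ℝ) (ψ : Param p) : ℝ :=
  ∫ z, ∫ y, varTerm γ y z.1 z.2 ψ
    ∂(gaussianReal (inner ℝ z.1 ψstar.1) (ψstar.2 + z.2).toNNReal) ∂ν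

/-- `δ` is a probability density on the real line. -/
structure IsProbDensity (δ : ℝ → ℝ) : Prop where
  measurable : Measurable δ
  nonneg : ∀ θ, 0 ≤ δ θ
  lintegral_eq_one : ∫⁻ θ, ENNReal.ofReal (δ θ) = 1

/-- The mean `μ_δ`. -/
def densityMean (δ : ℝ → ℝ) : ℝ := ∫ θ, θ * δ θ

/-- The density `(1 - ω) φ(θ; xᵀβ⋆, A⋆) + ω δ(θ)` of `θ` given the covariate `x`. -/
def contaminatedDensity {p : ℕ} (ω : ℝ) (ψstar : Param p) (δ : ℝ → ℝ) (x : Cov p)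
    (θ : ℝ) : ℝ :=
  (1 - ω) * phi θ (inner ℝ x ψstar.1) ψstar.2 + ω * δ θ

/-- The joint law of `((x, D), (θ, y))` when `(x, D) ~ ν`, `θ | x, D` has the contaminated
density and `y | θ, x, D ~ N(θ, D)`. -/
def jointLaw {p : ℕ} (ν : Measure (Cov p × ℝ)) (ω : ℝ) (ψstar : Param p) (δ : ℝ → ℝ) :
    Measure ((Cov p × ℝ) × (ℝ × ℝ)) :=
  (ν.prod (volume.prod volume)).withDensity fun z =>
    ENNReal.ofReal
      (contaminatedDensity ω ψstar δ z.1.1 z.2.1 * phi z.2.2 z.2.1 z.1.2)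

/-- The law of an observation `(y, x, D)` under the contaminated model. -/
def obsLaw {p : ℕ} (ν : Measure (Cov p × ℝ)) (ω : ℝ) (ψstar : Param p) (δ : ℝ → ℝ) :
    Measure (Obs p) :=
  (jointLaw ν ω ψstar δ).map fun z => (z.2.2, z.1.1, z.1.2)

/-- The marginal density `f_δ(y) = ∫ φ(y; θ, D) δ(θ) dθ`. -/
def margDensity (δ : ℝ → ℝ) (D y : ℝ) : ℝ≥0∞ :=
  ∫⁻ θ, ENNReal.ofReal (phi y θ D * δ θ)

/-- The separability quantity `ρ = ρ(ψ⋆, γ, δ)`. -/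
def rho {p : ℕ} (X : Set (Cov p)) (DL DU : ℝ) (ψstar : Param p) (γ : ℝ) (δ : ℝ → ℝ) :
    ℝ≥0∞ :=
  ⨆ k ∈ ({0, 1, 2} : Finset ℕ), ⨆ D ∈ Set.Icc DL DU, ⨆ x ∈ X,
    ∫⁻ y, margDensity δ D y *
      ENNReal.ofReal (phi y (inner ℝ x ψstar.1) (ψstar.2 + D) ^ γ *
        |y - inner ℝ x ψstar.1| ^ k)

/-- The score `∂_ψ 𝒟_γ(z; ψ)` at `z = (y, x, D)`, as a linear form on the parameter space. -/
def score {p : ℕ} (γ : ℝ) (z : Obs p) (ψ : Param p) : Param p →L[ℝ] ℝ :=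
  fderiv ℝ (gammaLik γ z.1 z.2.1 z.2.2) ψ

/-- The derivative of the score in the parameter (the Hessian of `𝒟_γ(z; ψ)`). -/
def scoreDeriv {p : ℕ} (γ : ℝ) (z : Obs p) (ψ : Param p) : Param p →L[ℝ] Param p →L[ℝ] ℝ :=
  fderiv ℝ (score γ z) ψ

/-- Regularity conditions (a)-(e) on the score at the pseudo-true parameter `ψdag`, where `F`
is the law of an observation. -/
structure ScoreRegularity {p : ℕ} (F : Measure (Obs p)) (X : Set (Cov p)) (DL DU : ℝ)
    (Ψ : Set (Param p)) (γ : ℝ) (ψdag : Param p) : Prop where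
  mem : ψdag ∈ Ψ
  /-- (a) The score is twice continuously differentiable in the parameter. -/
  smooth : ∀ y : ℝ, ∀ x ∈ X, ∀ D ∈ Set.Icc DL DU,
    ContDiffOn ℝ 2 (score γ (y, x, D)) {ψ | 0 < ψ.2}
  /-- (b) `ψdag` is a root of the expected score. -/
  root : Integrable (fun z => score γ z ψdag) F ∧ ∫ z, score γ z ψdag ∂F = 0
  /-- (c) The score is square integrable. -/
  sq_integrable : ∀ ψ ∈ Ψ, Integrable (fun z => ‖score γ z ψ‖ ^ 2) F
  /-- (d) The expected derivative of the score exists and is nonsingular. -/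
  nonsingular : Integrable (fun z => scoreDeriv γ z ψdag) F ∧
    Function.Bijective ⇑(∫ z, scoreDeriv γ z ψdag ∂F)
  /-- (e) The second-order derivatives of the score are dominated near `ψdag`. -/
  dominated : ∃ U ∈ 𝓝 ψdag, ∃ Dbar : Obs p → ℝ, Integrable Dbar F ∧
    ∀ᵐ z ∂F, ∀ ψ ∈ U, ‖fderiv ℝ (scoreDeriv γ z) ψ‖ ≤ Dbar z

/-- `ψhat` maximizes `∑_{i < m} 𝒟_γ(y_i; ψ)` (for `γ = 0`: the marginal log-likelihood)
over the parameter space `Ψ`. -/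
def IsEstimate {p : ℕ} (Ψ : Set (Param p)) (γ : ℝ) (m : ℕ) (y : ℕ → ℝ) (x : ℕ → Cov p)
    (D : ℕ → ℝ) (ψhat : Param p) : Prop :=
  ψhat ∈ Ψ ∧
    IsMaxOn (fun ψ => ∑ i ∈ Finset.range m, gammaLik γ (y i) (x i) (D i) ψ) Ψ ψhat

/-- `γop` minimizes `∑_{i < m} ŝ_i²^(γ)` over `γ ∈ Γ`, where `ŝ_i²^(γ)` is the robust
posterior variance at the estimate `ψhat γ`. -/
def IsSelected {p : ℕ} (Γ : Finset ℝ) (m : ℕ) (y : ℕ → ℝ) (x : ℕ → Cov p)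
    (D : ℕ → ℝ) (ψhat : ℝ → Param p) (γop : ℝ) : Prop :=
  γop ∈ Γ ∧
    IsMinOn (fun γ => ∑ i ∈ Finset.range m, robustVar γ (y i) (x i) (D i) (ψhat γ)) (Γ : Set ℝ) γop

end

end RobustFayHerriot

/-!
For `γ > 0` both the `γ`-likelihood and the variance term `v_γ(y, x, D; ψ)` are `O(1 / (1 + y²))`,
uniformly over compact sets of `(x, D)` and `ψ`. Smallness of `ρ` forces the contaminating part of
the law of `y` to live far from the origin, so it contributes almost nothing to their averages: a
uniform law of large numbers brings these averages close to `1 - ω` times their means under the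
uncontaminated model. There the Gaussian `γ`-likelihood has `ψ⋆` as its unique maximiser, hence the
average of `v_γ` at the estimate is eventually at most `(1 - ω) Q(γ; ψ⋆) + κ`.

For `γ = 0` the same contamination makes the average of `y²` huge. The Gaussian likelihood
penalises a variance below `A⋆` by a multiple of `y²`, so the estimate of `A` is eventually above
`A⋆ - κ`; as `v_0 = -D² / (A + D)` increases with `A`, its average is eventually at least
`Q(0; ψ⋆) - κ`. Since `Q(0; ψ⋆) > (1 - ω) Q(γ⋆; ψ⋆)`, eventually `γ⋆` has a smaller estimated
risk than `0`, and `0` is not selected.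
-/

namespace RobustFayHerriot

section Phi

theorem phi_eq {v : ℝ} (hv : 0 < v) (y μ : ℝ) :
    phi y μ v = (√(2 * Real.pi * v))⁻¹ * Real.exp (-(y - μ) ^ 2 / (2 * v)) := by
  simp [phi, gaussianPDFReal, Real.coe_toNNReal v hv.le]

theorem phi_nonneg (y μ v : ℝ) : 0 ≤ phi y μ v := gaussianPDFReal_nonneg _ _ _

theorem log_phi {v : ℝ} (hv : 0 < v) (y μ : ℝ) :
    Real.log (phi y μ v) = -(Real.log (2 * Real.pi * v) / 2) - (y - μ) ^ 2 / (2 * v) := by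
  rw [phi_eq hv, Real.log_mul (by positivity) (Real.exp_ne_zero _), Real.log_exp, Real.log_inv,
    Real.log_sqrt (by positivity)]
  ring

theorem phi_pos {v : ℝ} (hv : 0 < v) (y μ : ℝ) : 0 < phi y μ v :=
  gaussianPDFReal_pos _ _ _ (by simpa using hv)

theorem continuousOn_phi :
    ContinuousOn (fun q : ℝ × ℝ × ℝ => phi q.1 q.2.1 q.2.2) {q | 0 < q.2.2} := by
  refine ContinuousOn.congr (f := fun q : ℝ × ℝ × ℝ => (√(2 * Real.pi * q.2.2))⁻¹ *
    Real.exp (-(q.1 - q.2.1) ^ 2 / (2 * q.2.2)))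
    (fun q hq => ContinuousAt.continuousWithinAt ?_) fun q hq => phi_eq hq _ _
  have hv : 0 < q.2.2 := hq
  have hsqrt : √(2 * Real.pi * q.2.2) ≠ 0 := by positivity
  have hden : 2 * q.2.2 ≠ 0 := by positivity
  fun_prop (disch := assumption)

@[fun_prop]
theorem measurable_phi {α : Type*} [MeasurableSpace α] {f g h : α → ℝ}
    (hf : Measurable f) (hg : Measurable g) (hh : Measurable h) :
    Measurable fun a => phi (f a) (g a) (h a) := by
  unfold phi gaussianPDFReal
  fun_prop

theorem lintegral_phi {v : ℝ} (hv : 0 < v) (μ : ℝ) :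
    ∫⁻ y, ENNReal.ofReal (phi y μ v) = 1 :=
  lintegral_gaussianPDFReal_eq_one μ (by simpa using hv)

theorem integral_gaussianReal_eq_integral_phi_mul {v : ℝ} (hv : 0 < v) (μ : ℝ) (f : ℝ → ℝ) :
    ∫ y, f y ∂gaussianReal μ v.toNNReal = ∫ y, phi y μ v * f y := by
  simpa only [phi, smul_eq_mul] using
    integral_gaussianReal_eq_integral_smul (μ := μ) (f := f) (by simpa using hv)

theorem phi_mul_phi {v₁ v₂ : ℝ} (h₁ : 0 < v₁) (h₂ : 0 < v₂) (θ a y : ℝ) :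
    phi θ a v₁ * phi y θ v₂ =
      phi y a (v₁ + v₂) *
        phi θ ((v₂ * a + v₁ * y) / (v₁ + v₂)) (v₁ * v₂ / (v₁ + v₂)) := by
  have normalization : 2 * Real.pi * v₁ * (2 * Real.pi * v₂) =
      2 * Real.pi * (v₁ + v₂) * (2 * Real.pi * (v₁ * v₂ / (v₁ + v₂))) := by field_simp
  have exponent : -(θ - a) ^ 2 / (2 * v₁) + -(y - θ) ^ 2 / (2 * v₂) =
      -(y - a) ^ 2 / (2 * (v₁ + v₂)) +
        -(θ - (v₂ * a + v₁ * y) / (v₁ + v₂)) ^ 2 / (2 * (v₁ * v₂ / (v₁ + v₂))) := by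
    field_simp
    ring
  rw [phi_eq h₁, phi_eq h₂, phi_eq (add_pos h₁ h₂), phi_eq (by positivity),
    mul_mul_mul_comm, mul_mul_mul_comm (√(2 * Real.pi * (v₁ + v₂)))⁻¹, ← Real.exp_add,
    ← Real.exp_add, ← mul_inv, ← mul_inv, ← Real.sqrt_mul (by positivity),
    ← Real.sqrt_mul (by positivity), normalization, exponent]

theorem lintegral_phi_mul_phi {v₁ v₂ : ℝ} (h₁ : 0 < v₁) (h₂ : 0 < v₂) (a y : ℝ) :
    ∫⁻ θ, ENNReal.ofReal (phi θ a v₁ * phi y θ v₂) =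
      ENNReal.ofReal (phi y a (v₁ + v₂)) := by
  simp_rw [phi_mul_phi h₁ h₂, ENNReal.ofReal_mul (phi_nonneg _ _ _)]
  rw [lintegral_const_mul _ (by fun_prop), lintegral_phi (by positivity), mul_one]

theorem integral_phi_mul_phi {v₁ v₂ : ℝ} (h₁ : 0 < v₁) (h₂ : 0 < v₂) (a y : ℝ) :
    ∫ θ, phi θ a v₁ * phi y θ v₂ = phi y a (v₁ + v₂) := by
  rw [integral_eq_lintegral_of_nonneg_ae
      (.of_forall fun _ => mul_nonneg (phi_nonneg _ _ _) (phi_nonneg _ _ _)) (by fun_prop),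
    lintegral_phi_mul_phi h₁ h₂, ENNReal.toReal_ofReal (phi_nonneg _ _ _)]

end Phi

section Weight

variable {p : ℕ} {γ D : ℝ} {ψ : Param p}

theorem weight_eq (hγ : 0 ≤ γ) (hV : 0 < ψ.2 + D) (y : ℝ) (x : Cov p) :
    weight γ y x D ψ = (2 * Real.pi * (ψ.2 + D)) ^ (-(γ / (2 * (1 + γ)))) *
      Real.exp (-(γ * (y - inner ℝ x ψ.1) ^ 2 / (2 * (ψ.2 + D)))) := by
  have hV' : 0 < 2 * Real.pi * (ψ.2 + D) := by positivity
  rw [weight, phi_eq hV, Real.mul_rpow (by positivity) (by positivity), ← Real.exp_mul,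
    Real.sqrt_eq_rpow, ← Real.rpow_neg hV'.le, ← Real.rpow_mul hV'.le, mul_right_comm,
    ← Real.rpow_add hV']
  congr 2
  · field_simp
    ring
  · ring

theorem weight_pos (hγ : 0 ≤ γ) (hV : 0 < ψ.2 + D) (y : ℝ) (x : Cov p) :
    0 < weight γ y x D ψ := by
  rw [weight_eq hγ hV]
  positivity

theorem gammaLik_zero (hV : 0 < ψ.2 + D) (y : ℝ) (x : Cov p) :
    gammaLik 0 y x D ψ =
      -(Real.log (2 * Real.pi * (ψ.2 + D)) / 2) -
        (y - inner ℝ x ψ.1) ^ 2 / (2 * (ψ.2 + D)) := by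
  rw [gammaLik, if_pos rfl, log_phi hV]

theorem varTerm_zero (hV : 0 < ψ.2 + D) (y : ℝ) (x : Cov p) :
    varTerm 0 y x D ψ = -(D ^ 2 / (ψ.2 + D)) := by
  rw [varTerm, weight_eq le_rfl hV]
  simp only [zero_div, neg_zero, Real.rpow_zero, zero_mul, Real.exp_zero, mul_one, one_mul,
    zero_sub]
  field_simp

theorem continuousOn_weight (hγ : 0 ≤ γ) :
    ContinuousOn (fun q : Obs p × Param p => weight γ q.1.1 q.1.2.1 q.1.2.2 q.2)
      {q | 0 < q.2.2 + q.1.2.2} := by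
  have hφ : ContinuousOn
      (fun q : Obs p × Param p => phi q.1.1 (inner ℝ q.1.2.1 q.2.1) (q.2.2 + q.1.2.2))
      {q | 0 < q.2.2 + q.1.2.2} :=
    continuousOn_phi.comp (f := fun q : Obs p × Param p =>
      (q.1.1, (inner ℝ q.1.2.1 q.2.1 : ℝ), q.2.2 + q.1.2.2)) (by fun_prop) fun _ hq => hq
  refine (hφ.rpow_const fun _ _ => .inr hγ).mul (.rpow_const (by fun_prop) fun q hq => .inl ?_)
  have hV : 0 < q.2.2 + q.1.2.2 := hq
  positivity

theorem continuousOn_gammaLik (hγ : 0 < γ) :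
    ContinuousOn (fun q : Obs p × Param p => gammaLik γ q.1.1 q.1.2.1 q.1.2.2 q.2)
      {q | 0 < q.2.2 + q.1.2.2} := by
  simpa only [gammaLik, if_neg hγ.ne'] using (continuousOn_weight hγ.le).const_mul (1 / γ)

theorem continuousOn_varTerm (hγ : 0 ≤ γ) :
    ContinuousOn (fun q : Obs p × Param p => varTerm γ q.1.1 q.1.2.1 q.1.2.2 q.2)
      {q | 0 < q.2.2 + q.1.2.2} := by
  unfold varTerm
  refine ((continuousOn_weight hγ).mul (ContinuousOn.div (by fun_prop) (by fun_prop) ?_)).mul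
    (by fun_prop)
  exact fun q (hq : 0 < q.2.2 + q.1.2.2) => (pow_pos hq 2).ne'

end Weight

section Decay

variable {p : ℕ} {γ D : ℝ} {ψ : Param p}

theorem one_add_sq_mul_exp_neg_le {t : ℝ} (ht : 0 ≤ t) :
    (1 + t) ^ 2 * Real.exp (-t) ≤ 2 := by
  rw [Real.exp_neg, ← div_eq_mul_inv, div_le_iff₀ (Real.exp_pos t)]
  linarith [Real.quadratic_le_exp_of_nonneg ht]

/-- The constant `K` in the bound `w_γ(y) (1 + t) ≤ K / (1 + y²)`, where
`t = γ (y - xᵀβ)² / (2 (A + D))`. -/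
noncomputable def envelope (γ : ℝ) (x : Cov p) (D : ℝ) (ψ : Param p) : ℝ :=
  2 * (2 * Real.pi * (ψ.2 + D)) ^ (-(γ / (2 * (1 + γ)))) *
    (1 + 2 * inner ℝ x ψ.1 ^ 2 + 4 * (ψ.2 + D) / γ)

theorem continuousOn_envelope :
    ContinuousOn (fun q : (Cov p × ℝ) × Param p => envelope γ q.1.1 q.1.2 q.2)
      {q | 0 < q.2.2 + q.1.2} := by
  refine ((ContinuousOn.rpow_const (by fun_prop) fun q hq => .inl ?_).const_mul 2).mul
    (by fun_prop)
  have hV : 0 < q.2.2 + q.1.2 := hq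
  positivity

theorem weight_mul_one_add_le (hγ : 0 < γ) (hV : 0 < ψ.2 + D) (y : ℝ) (x : Cov p) :
    weight γ y x D ψ * (1 + γ * (y - inner ℝ x ψ.1) ^ 2 / (2 * (ψ.2 + D))) ≤
      envelope γ x D ψ * (1 + y ^ 2)⁻¹ := by
  rw [weight_eq hγ.le hV, envelope, ← div_eq_mul_inv, le_div_iff₀ (by positivity)]
  set μ : ℝ := inner ℝ x ψ.1
  set c := (2 * Real.pi * (ψ.2 + D)) ^ (-(γ / (2 * (1 + γ))))
  set t := γ * (y - μ) ^ 2 / (2 * (ψ.2 + D)) with ht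
  set K := 1 + 2 * μ ^ 2 + 4 * (ψ.2 + D) / γ
  have ht0 : 0 ≤ t := by positivity
  have hy : 1 + y ^ 2 ≤ K * (1 + t) := by
    have : 4 * (ψ.2 + D) / γ * t = 2 * (y - μ) ^ 2 := by rw [ht]; field_simp; ring
    have h4 : 0 ≤ 4 * (ψ.2 + D) / γ := by positivity
    nlinarith [sq_nonneg (y - 2 * μ), mul_nonneg (sq_nonneg μ) ht0]
  calc c * Real.exp (-t) * (1 + t) * (1 + y ^ 2)
      ≤ c * Real.exp (-t) * (1 + t) * (K * (1 + t)) := by gcongr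
    _ = c * K * ((1 + t) ^ 2 * Real.exp (-t)) := by ring
    _ ≤ c * K * 2 := by gcongr; exact one_add_sq_mul_exp_neg_le ht0
    _ = 2 * c * K := by ring

theorem abs_gammaLik_le (hγ : 0 < γ) (hV : 0 < ψ.2 + D) (y : ℝ) (x : Cov p) :
    |gammaLik γ y x D ψ| ≤ 1 / γ * envelope γ x D ψ * (1 + y ^ 2)⁻¹ := by
  have hw := weight_pos hγ.le hV y x
  rw [gammaLik, if_neg hγ.ne', abs_of_pos (by positivity), mul_assoc]
  gcongr
  refine le_trans (le_mul_of_one_le_right hw.le ?_) (weight_mul_one_add_le hγ hV y x)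
  simp only [le_add_iff_nonneg_right]
  positivity

theorem abs_varTerm_le (hγ : 0 < γ) (hA : 0 ≤ ψ.2) (hD : 0 < D) (y : ℝ) (x : Cov p) :
    |varTerm γ y x D ψ| ≤ 2 * (ψ.2 + D) * envelope γ x D ψ * (1 + y ^ 2)⁻¹ := by
  have hV : 0 < ψ.2 + D := by positivity
  have hw := weight_pos hγ.le hV y x
  set r := γ * (y - inner ℝ x ψ.1) ^ 2
  have hr0 : 0 ≤ r := by positivity
  have hshrink : D ^ 2 / (ψ.2 + D) ^ 2 ≤ 1 := by
    rw [div_le_one (by positivity)]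
    gcongr
    linarith
  have hfactor : |r - (ψ.2 + D)| ≤ 2 * (ψ.2 + D) * (1 + r / (2 * (ψ.2 + D))) := by
    have : 2 * (ψ.2 + D) * (1 + r / (2 * (ψ.2 + D))) = 2 * (ψ.2 + D) + r := by field_simp
    rw [this, abs_le]
    constructor <;> linarith
  rw [varTerm, abs_mul, abs_mul, abs_of_pos hw, abs_of_nonneg (by positivity)]
  calc weight γ y x D ψ * (D ^ 2 / (ψ.2 + D) ^ 2) * |r - (ψ.2 + D)|
      ≤ weight γ y x D ψ * 1 * (2 * (ψ.2 + D) * (1 + r / (2 * (ψ.2 + D)))) := by gcongr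
    _ = 2 * (ψ.2 + D) * (weight γ y x D ψ * (1 + r / (2 * (ψ.2 + D)))) := by ring
    _ ≤ 2 * (ψ.2 + D) * (envelope γ x D ψ * (1 + y ^ 2)⁻¹) := by
        gcongr ?_ * ?_
        exact weight_mul_one_add_le hγ hV y x
    _ = _ := by ring

end Decay

section ExpectedWeight

variable {p : ℕ} {γ D : ℝ} {ψ ψ₀ : Param p}

theorem integral_gaussianReal_weight (hγ : 0 < γ) {V₀ : ℝ} (hV : 0 < ψ.2 + D) (hV₀ : 0 < V₀)
    (x : Cov p) (a : ℝ) :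
    ∫ y, weight γ y x D ψ ∂gaussianReal a V₀.toNNReal =
      (2 * Real.pi * (ψ.2 + D)) ^ (-(γ / (2 * (1 + γ)))) *
        (√((ψ.2 + D + γ * V₀) / (ψ.2 + D)))⁻¹ *
          Real.exp (-(γ * (inner ℝ x ψ.1 - a) ^ 2 / (2 * (ψ.2 + D + γ * V₀)))) := by
  rw [integral_gaussianReal_eq_integral_phi_mul hV₀]
  set V := ψ.2 + D
  -- As a function of `y`, the weight is a multiple of a normal density of variance `V / γ`.
  have hweight : ∀ y, phi y a V₀ * weight γ y x D ψ =
      ((2 * Real.pi * V) ^ (-(γ / (2 * (1 + γ)))) * √(2 * Real.pi * (V / γ))) *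
        (phi y a V₀ * phi (inner ℝ x ψ.1) y (V / γ)) := by
    intro y
    have hexp : -(inner ℝ x ψ.1 - y) ^ 2 / (2 * (V / γ)) =
        -(γ * (y - inner ℝ x ψ.1) ^ 2 / (2 * V)) := by
      field_simp
      ring
    rw [weight_eq hγ.le hV, phi_eq (v := V / γ) (by positivity), hexp]
    field_simp
    rfl
  have hscale : √(2 * Real.pi * (V / γ)) * (√(2 * Real.pi * (V₀ + V / γ)))⁻¹ =
      (√((V + γ * V₀) / V))⁻¹ := by
    rw [← Real.sqrt_inv, ← Real.sqrt_inv, ← Real.sqrt_mul (by positivity)]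
    congr 1
    field_simp
    ring
  have hexp : -(inner ℝ x ψ.1 - a) ^ 2 / (2 * (V₀ + V / γ)) =
      -(γ * (inner ℝ x ψ.1 - a) ^ 2 / (2 * (V + γ * V₀))) := by
    field_simp
    ring
  simp_rw [hweight]
  rw [integral_const_mul, integral_phi_mul_phi hV₀ (by positivity), phi_eq (by positivity), hexp,
    ← hscale]
  ring

theorem rpow_mul_inv_sqrt_lt {V V₀ : ℝ} (hγ : 0 < γ) (hV : 0 < V) (hV₀ : 0 < V₀)
    (hne : V ≠ V₀) :
    (2 * Real.pi * V) ^ (-(γ / (2 * (1 + γ)))) * (√((V + γ * V₀) / V))⁻¹ <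
      (2 * Real.pi * V₀) ^ (-(γ / (2 * (1 + γ)))) * (√((V₀ + γ * V₀) / V₀))⁻¹ := by
  obtain ⟨r, hr, rfl⟩ : ∃ r, 0 < r ∧ V₀ = V * r := ⟨V₀ / V, by positivity, by field_simp⟩
  have hr1 : r ≠ 1 := by
    rintro rfl
    simp at hne
  have bernoulli : r ^ (γ / (1 + γ)) < 1 + γ / (1 + γ) * (r - 1) := by
    simpa only [add_sub_cancel] using
      rpow_one_add_lt_one_add_mul_self (s := r - 1) (p := γ / (1 + γ)) (by linarith)
        (sub_ne_zero.2 hr1) (by positivity) (by rw [div_lt_one (by positivity)]; linarith)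
  have hlt : r ^ (γ / (1 + γ)) * (1 + γ) < 1 + γ * r :=
    calc r ^ (γ / (1 + γ)) * (1 + γ) < (1 + γ / (1 + γ) * (r - 1)) * (1 + γ) := by gcongr
      _ = 1 + γ * r := by field_simp; ring
  have hsqrt : r ^ (γ / (2 * (1 + γ))) = √(r ^ (γ / (1 + γ))) := by
    rw [Real.sqrt_eq_rpow, ← Real.rpow_mul hr.le]
    congr 1
    field_simp
  rw [show (V + γ * (V * r)) / V = 1 + γ * r by field_simp,
    show (V * r + γ * (V * r)) / (V * r) = 1 + γ by field_simp,
    show 2 * Real.pi * (V * r) = 2 * Real.pi * V * r by ring,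
    Real.mul_rpow (by positivity) hr.le, mul_assoc (_ ^ _) (r ^ _), Real.rpow_neg hr.le,
    ← mul_inv, hsqrt, ← Real.sqrt_mul (by positivity)]
  gcongr

theorem integral_gaussianReal_weight_lt (hγ : 0 < γ) (hV : 0 < ψ.2 + D) (hV₀ : 0 < ψ₀.2 + D)
    {x : Cov p} (hne : inner ℝ x ψ.1 ≠ (inner ℝ x ψ₀.1 : ℝ) ∨ ψ.2 ≠ ψ₀.2) :
    ∫ y, weight γ y x D ψ ∂gaussianReal (inner ℝ x ψ₀.1) (ψ₀.2 + D).toNNReal <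
      ∫ y, weight γ y x D ψ₀ ∂gaussianReal (inner ℝ x ψ₀.1) (ψ₀.2 + D).toNNReal := by
  rw [integral_gaussianReal_weight hγ hV hV₀, integral_gaussianReal_weight hγ hV₀ hV₀]
  simp only [sub_self, ne_eq, OfNat.ofNat_ne_zero, not_false_eq_true, zero_pow, mul_zero,
    zero_div, neg_zero, Real.exp_zero, mul_one]
  rcases eq_or_ne ψ.2 ψ₀.2 with hA | hA
  · have hμ : inner ℝ x ψ.1 - inner ℝ x ψ₀.1 ≠ (0 : ℝ) :=
      sub_ne_zero.2 (hne.resolve_right (not_not.2 hA))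
    rw [hA]
    refine mul_lt_of_lt_one_right (by positivity) (Real.exp_lt_one_iff.2 (neg_neg_of_pos ?_))
    positivity
  · refine lt_of_le_of_lt (mul_le_of_le_one_right (by positivity) (Real.exp_le_one_iff.2 ?_))
      (rpow_mul_inv_sqrt_lt hγ hV hV₀ fun h => hA (by linarith))
    exact neg_nonpos.2 (by positivity)

end ExpectedWeight

section DensityLaw

variable {α : Type*} [MeasurableSpace α] {ν : Measure α} {g h : ℝ × α → ℝ≥0∞}

/-- The law of `(y, z)` when `z ~ ν` and `y` has density `g (·, z)` given `z`. -/
noncomputable def densityLaw (ν : Measure α) (g : ℝ × α → ℝ≥0∞) : Measure (ℝ × α) :=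
  (volume.prod ν).withDensity g

theorem lintegral_densityLaw [SFinite ν] (hg : Measurable g) {f : ℝ × α → ℝ≥0∞}
    (hf : Measurable f) :
    ∫⁻ w, f w ∂densityLaw ν g = ∫⁻ z, (∫⁻ y, g (y, z) * f (y, z)) ∂ν := by
  rw [densityLaw, lintegral_withDensity_eq_lintegral_mul _ hg hf,
    lintegral_prod_symm _ (hg.mul hf).aemeasurable]
  rfl

theorem densityLaw_congr_ae (hgh : ∀ᵐ z ∂ν, ∀ y, g (y, z) = h (y, z)) :
    densityLaw ν g = densityLaw ν h :=
  withDensity_congr_ae <|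
    (Measure.quasiMeasurePreserving_snd.ae hgh).mono fun w hw => hw w.1

theorem densityLaw_smul_add_smul (hg : Measurable g) (hh : Measurable h) (a b : ℝ≥0∞) :
    densityLaw ν (a • g + b • h) = a • densityLaw ν g + b • densityLaw ν h := by
  simp only [densityLaw, withDensity_add_left (hg.const_smul a), withDensity_smul _ hg,
    withDensity_smul _ hh]

theorem measurePreserving_snd_densityLaw [SFinite ν] (hg : Measurable g)
    (hg₁ : ∀ᵐ z ∂ν, ∫⁻ y, g (y, z) = 1) : MeasurePreserving Prod.snd (densityLaw ν g) ν := by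
  refine ⟨measurable_snd, Measure.ext_of_lintegral _ fun f hf => ?_⟩
  rw [lintegral_map hf measurable_snd, lintegral_densityLaw hg (by fun_prop)]
  refine lintegral_congr_ae (hg₁.mono fun z hz => ?_)
  simp only
  rw [lintegral_mul_const _ (by fun_prop), hz, one_mul]

end DensityLaw

section Laws

variable {p : ℕ} {ν : Measure (Cov p × ℝ)} {ψ₀ : Param p} {δ : ℝ → ℝ} {ω : ℝ}

/-- The law of an observation `(y, x, D)` without contamination: `(x, D) ~ ν` and
`y | x, D ~ N(xᵀβ₀, A₀ + D)`, where `ψ₀ = (β₀, A₀)`. -/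
noncomputable def coreLaw (ν : Measure (Cov p × ℝ)) (ψ₀ : Param p) : Measure (Obs p) :=
  densityLaw ν fun w => ENNReal.ofReal (phi w.1 (inner ℝ w.2.1 ψ₀.1) (ψ₀.2 + w.2.2))

/-- The law of a contaminated observation `(y, x, D)`: `(x, D) ~ ν`, `θ` has density `δ` and
`y | θ, x, D ~ N(θ, D)`. -/
noncomputable def contLaw (ν : Measure (Cov p × ℝ)) (δ : ℝ → ℝ) : Measure (Obs p) :=
  densityLaw ν fun w => margDensity δ w.2.2 w.1

@[fun_prop]
theorem measurable_margDensity {α : Type*} [MeasurableSpace α] (hδ : Measurable δ)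
    {f g : α → ℝ} (hf : Measurable f) (hg : Measurable g) :
    Measurable fun a => margDensity δ (f a) (g a) :=
  Measurable.lintegral_prod_right'
    (f := fun q : α × ℝ => ENNReal.ofReal (phi (g q.1) q.2 (f q.1) * δ q.2)) (by fun_prop)

theorem lintegral_margDensity (hδ : IsProbDensity δ) {D : ℝ} (hD : 0 < D) :
    ∫⁻ y, margDensity δ D y = 1 := by
  have hδm := hδ.measurable
  unfold margDensity
  rw [lintegral_lintegral_swap (by fun_prop), ← hδ.lintegral_eq_one]
  simp_rw [ENNReal.ofReal_mul (phi_nonneg _ _ _)]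
  congr 1 with θ
  rw [lintegral_mul_const _ (by fun_prop), lintegral_phi hD, one_mul]

theorem lintegral_contaminatedDensity_mul_phi (hA : 0 < ψ₀.2) (hδ : IsProbDensity δ)
    (hω : ω ∈ Set.Icc (0 : ℝ) 1) {D : ℝ} (hD : 0 < D) (x : Cov p) (y : ℝ) :
    ∫⁻ θ, ENNReal.ofReal (contaminatedDensity ω ψ₀ δ x θ * phi y θ D) =
      ENNReal.ofReal (1 - ω) * ENNReal.ofReal (phi y (inner ℝ x ψ₀.1) (ψ₀.2 + D)) +
        ENNReal.ofReal ω * margDensity δ D y := by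
  have hδm := hδ.measurable
  have hω' : 0 ≤ 1 - ω := sub_nonneg.2 hω.2
  have hsplit : ∀ θ, ENNReal.ofReal (contaminatedDensity ω ψ₀ δ x θ * phi y θ D) =
      ENNReal.ofReal (1 - ω) * ENNReal.ofReal (phi θ (inner ℝ x ψ₀.1) ψ₀.2 * phi y θ D) +
        ENNReal.ofReal ω * ENNReal.ofReal (phi y θ D * δ θ) := by
    intro θ
    have hcore : 0 ≤ phi θ (inner ℝ x ψ₀.1) ψ₀.2 * phi y θ D :=
      mul_nonneg (phi_nonneg _ _ _) (phi_nonneg _ _ _)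
    have hcont : 0 ≤ phi y θ D * δ θ := mul_nonneg (phi_nonneg _ _ _) (hδ.nonneg θ)
    rw [← ENNReal.ofReal_mul hω', ← ENNReal.ofReal_mul hω.1,
      ← ENNReal.ofReal_add (mul_nonneg hω' hcore) (mul_nonneg hω.1 hcont), contaminatedDensity]
    congr 1
    ring
  simp only [hsplit]
  rw [lintegral_add_left (by fun_prop), lintegral_const_mul _ (by fun_prop),
    lintegral_const_mul _ (by fun_prop), lintegral_phi_mul_phi hA hD]
  rfl

theorem obsLaw_eq_densityLaw [SFinite ν] (hδ : Measurable δ) :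
    obsLaw ν ω ψ₀ δ = densityLaw ν fun w =>
      ∫⁻ θ, ENNReal.ofReal (contaminatedDensity ω ψ₀ δ w.2.1 θ * phi w.1 θ w.2.2) := by
  have hjoint : Measurable fun z : (Cov p × ℝ) × (ℝ × ℝ) => ENNReal.ofReal
      (contaminatedDensity ω ψ₀ δ z.1.1 z.2.1 * phi z.2.2 z.2.1 z.1.2) := by
    unfold contaminatedDensity
    fun_prop
  have hmarg : Measurable fun w : Obs p =>
      ∫⁻ θ, ENNReal.ofReal (contaminatedDensity ω ψ₀ δ w.2.1 θ * phi w.1 θ w.2.2) :=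
    Measurable.lintegral_prod_right' (f := fun q : Obs p × ℝ => ENNReal.ofReal
      (contaminatedDensity ω ψ₀ δ q.1.2.1 q.2 * phi q.1.1 q.2 q.1.2.2)) <| by
        unfold contaminatedDensity
        fun_prop
  refine Measure.ext_of_lintegral _ fun f hf => ?_
  rw [lintegral_densityLaw hmarg hf, obsLaw, lintegral_map hf (by fun_prop), jointLaw,
    lintegral_withDensity_eq_lintegral_mul _ hjoint (by fun_prop),
    lintegral_prod _ (by fun_prop)]
  congr 1 with z
  rw [lintegral_prod_symm _ (by fun_prop)]
  congr 1 with y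
  rw [← lintegral_mul_const _ (by unfold contaminatedDensity; fun_prop)]
  rfl

theorem obsLaw_eq_add [SFinite ν] (hν : ∀ᵐ z ∂ν, 0 < z.2) (hA : 0 < ψ₀.2)
    (hδ : IsProbDensity δ) (hω : ω ∈ Set.Icc (0 : ℝ) 1) :
    obsLaw ν ω ψ₀ δ =
      ENNReal.ofReal (1 - ω) • coreLaw ν ψ₀ + ENNReal.ofReal ω • contLaw ν δ := by
  have hδm := hδ.measurable
  have hcore : Measurable fun w : Obs p =>
      ENNReal.ofReal (phi w.1 (inner ℝ w.2.1 ψ₀.1) (ψ₀.2 + w.2.2)) := by fun_prop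
  have hcont : Measurable fun w : Obs p => margDensity δ w.2.2 w.1 := by fun_prop
  unfold coreLaw contLaw
  rw [obsLaw_eq_densityLaw hδm, ← densityLaw_smul_add_smul hcore hcont]
  exact densityLaw_congr_ae <| hν.mono fun z hz y =>
    lintegral_contaminatedDensity_mul_phi hA hδ hω hz z.1 y

theorem measurePreserving_snd_coreLaw [SFinite ν] (hν : ∀ᵐ z ∂ν, 0 < z.2) (hA : 0 ≤ ψ₀.2) :
    MeasurePreserving Prod.snd (coreLaw ν ψ₀) ν :=
  measurePreserving_snd_densityLaw (by fun_prop) <| by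
    filter_upwards [hν] with z hz using lintegral_phi (by positivity) _

theorem measurePreserving_snd_contLaw [SFinite ν] (hν : ∀ᵐ z ∂ν, 0 < z.2)
    (hδ : IsProbDensity δ) : MeasurePreserving Prod.snd (contLaw ν δ) ν :=
  have := hδ.measurable
  measurePreserving_snd_densityLaw (by fun_prop) <|
    hν.mono fun _ hz => lintegral_margDensity hδ hz

theorem measurePreserving_snd_obsLaw [SFinite ν] (hν : ∀ᵐ z ∂ν, 0 < z.2) (hA : 0 < ψ₀.2)
    (hδ : IsProbDensity δ) (hω : ω ∈ Set.Icc (0 : ℝ) 1) :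
    MeasurePreserving Prod.snd (obsLaw ν ω ψ₀ δ) ν := by
  refine ⟨measurable_snd, ?_⟩
  rw [obsLaw_eq_add hν hA hδ hω, Measure.map_add _ _ measurable_snd, Measure.map_smul,
    Measure.map_smul, (measurePreserving_snd_coreLaw hν hA.le).map_eq,
    (measurePreserving_snd_contLaw hν hδ).map_eq, ← add_smul,
    ← ENNReal.ofReal_add (sub_nonneg.2 hω.2) hω.1, sub_add_cancel, ENNReal.ofReal_one, one_smul]

theorem integral_obsLaw [SFinite ν] (hν : ∀ᵐ z ∂ν, 0 < z.2) (hA : 0 < ψ₀.2)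
    (hδ : IsProbDensity δ) (hω : ω ∈ Set.Icc (0 : ℝ) 1) {f : Obs p → ℝ}
    (hcore : Integrable f (coreLaw ν ψ₀)) (hcont : Integrable f (contLaw ν δ)) :
    ∫ w, f w ∂obsLaw ν ω ψ₀ δ =
      (1 - ω) * ∫ w, f w ∂coreLaw ν ψ₀ + ω * ∫ w, f w ∂contLaw ν δ := by
  rw [obsLaw_eq_add hν hA hδ hω,
    integral_add_measure (hcore.smul_measure ENNReal.ofReal_ne_top)
      (hcont.smul_measure ENNReal.ofReal_ne_top),
    integral_smul_measure, integral_smul_measure, ENNReal.toReal_ofReal (sub_nonneg.2 hω.2),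
    ENNReal.toReal_ofReal hω.1, smul_eq_mul, smul_eq_mul]

theorem integrable_coreLaw_iff {f : Obs p → ℝ} :
    Integrable f (coreLaw ν ψ₀) ↔
      Integrable (fun w => phi w.1 (inner ℝ w.2.1 ψ₀.1) (ψ₀.2 + w.2.2) * f w)
        (volume.prod ν) := by
  rw [coreLaw, densityLaw, integrable_withDensity_iff_integrable_smul' (by fun_prop)
    (.of_forall fun _ => ENNReal.ofReal_lt_top)]
  simp only [ENNReal.toReal_ofReal (phi_nonneg _ _ _), smul_eq_mul]

theorem integrable_integral_gaussianReal [SFinite ν] (hν : ∀ᵐ z ∂ν, 0 < z.2) (hA : 0 ≤ ψ₀.2)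
    {f : Obs p → ℝ} (hf : Integrable f (coreLaw ν ψ₀)) :
    Integrable (fun z : Cov p × ℝ =>
      ∫ y, f (y, z) ∂gaussianReal (inner ℝ z.1 ψ₀.1) (ψ₀.2 + z.2).toNNReal) ν := by
  refine (integrable_coreLaw_iff.1 hf).integral_prod_right.congr ?_
  filter_upwards [hν] with z hz
  exact (integral_gaussianReal_eq_integral_phi_mul (by positivity) _ _).symm

theorem integral_coreLaw [SFinite ν] (hν : ∀ᵐ z ∂ν, 0 < z.2) (hA : 0 ≤ ψ₀.2)
    {f : Obs p → ℝ} (hf : Integrable f (coreLaw ν ψ₀)) :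
    ∫ w, f w ∂coreLaw ν ψ₀ =
      ∫ z, ∫ y, f (y, z) ∂gaussianReal (inner ℝ z.1 ψ₀.1) (ψ₀.2 + z.2).toNNReal ∂ν := by
  rw [coreLaw, densityLaw, integral_withDensity_eq_integral_toReal_smul (by fun_prop)
    (.of_forall fun _ => ENNReal.ofReal_lt_top)]
  simp only [ENNReal.toReal_ofReal (phi_nonneg _ _ _), smul_eq_mul]
  rw [integral_prod_symm _ (integrable_coreLaw_iff.1 hf)]
  refine integral_congr_ae ?_
  filter_upwards [hν] with z hz
  exact (integral_gaussianReal_eq_integral_phi_mul (by positivity) _ _).symm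

theorem hasLaw_obs {Ω : Type*} [MeasurableSpace Ω] {P : Measure Ω} {x : Ω → Cov p}
    {D θ y : Ω → ℝ}
    (h : HasLaw (fun s => ((x s, D s), (θ s, y s))) (jointLaw ν ω ψ₀ δ) P) :
    HasLaw (fun s => (y s, x s, D s)) (obsLaw ν ω ψ₀ δ) P :=
  HasLaw.comp (X := fun s => ((x s, D s), (θ s, y s))) (Y := fun z => (z.2.2, z.1.1, z.1.2))
    ⟨by fun_prop, rfl⟩ h

end Laws

section HasDecay

variable {p : ℕ} {T : Set (Cov p × ℝ)} {Ψ : Set (Param p)} {f : Obs p → Param p → ℝ}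

/-- `f (y, x, D) ψ` is jointly continuous and `O(1 / (1 + y²))`, uniformly in `(x, D) ∈ T` and
`ψ ∈ Ψ`: such statistics hardly see observations with large `|y|`. -/
structure HasDecay (T : Set (Cov p × ℝ)) (Ψ : Set (Param p)) (f : Obs p → Param p → ℝ) :
    Prop where
  continuousOn : ContinuousOn (Function.uncurry f) ((Prod.snd ⁻¹' T) ×ˢ Ψ)
  exists_bound : ∃ C, ∀ w : Obs p, w.2 ∈ T → ∀ ψ ∈ Ψ, |f w ψ| ≤ C * (1 + w.1 ^ 2)⁻¹

theorem HasDecay.exists_abs_le (hf : HasDecay T Ψ f) :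
    ∃ C, ∀ w : Obs p, w.2 ∈ T → ∀ ψ ∈ Ψ, |f w ψ| ≤ C := by
  obtain ⟨C, hC⟩ := hf.exists_bound
  refine ⟨|C|, fun w hw ψ hψ => (hC w hw ψ hψ).trans ?_⟩
  calc C * (1 + w.1 ^ 2)⁻¹ ≤ |C| * 1 := by
        gcongr
        · exact le_abs_self C
        · exact inv_le_one_of_one_le₀ (le_add_of_nonneg_right (sq_nonneg _))
    _ = |C| := mul_one _

theorem HasDecay.aestronglyMeasurable (hf : HasDecay T Ψ f) (hT : MeasurableSet T)
    {F : Measure (Obs p)} (hF : ∀ᵐ w ∂F, w.2 ∈ T) {ψ : Param p} (hψ : ψ ∈ Ψ) :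
    AEStronglyMeasurable (f · ψ) F := by
  rw [← Measure.restrict_eq_self_of_ae_mem (s := Prod.snd ⁻¹' T) hF]
  exact (hf.continuousOn.comp (f := fun w => (w, ψ)) (by fun_prop)
    fun w hw => ⟨hw, hψ⟩).aestronglyMeasurable (measurable_snd hT)

theorem HasDecay.integrable (hf : HasDecay T Ψ f) (hT : MeasurableSet T) {F : Measure (Obs p)}
    [IsFiniteMeasure F] (hF : ∀ᵐ w ∂F, w.2 ∈ T) {ψ : Param p} (hψ : ψ ∈ Ψ) :
    Integrable (f · ψ) F := by
  obtain ⟨C, hC⟩ := hf.exists_abs_le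
  exact .of_bound (hf.aestronglyMeasurable hT hF hψ) C (hF.mono fun w hw => hC w hw ψ hψ)

theorem HasDecay.continuousOn_integral (hf : HasDecay T Ψ f) (hT : MeasurableSet T)
    {F : Measure (Obs p)} [IsFiniteMeasure F] (hF : ∀ᵐ w ∂F, w.2 ∈ T) :
    ContinuousOn (fun ψ => ∫ w, f w ψ ∂F) Ψ := by
  obtain ⟨C, hC⟩ := hf.exists_abs_le
  refine continuousOn_of_dominated (bound := fun _ => C)
    (fun ψ hψ => hf.aestronglyMeasurable hT hF hψ)
    (fun ψ hψ => hF.mono fun w hw => hC w hw ψ hψ) (integrable_const C)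
    (hF.mono fun w hw => ?_)
  exact hf.continuousOn.comp (f := fun ψ => (w, ψ)) (by fun_prop) fun ψ hψ => ⟨hw, hψ⟩

theorem hasDecay_of_abs_le (hT : IsCompact T) (hΨ : IsCompact Ψ)
    (hf : ContinuousOn (Function.uncurry f) ((Prod.snd ⁻¹' T) ×ˢ Ψ))
    {K : (Cov p × ℝ) × Param p → ℝ} (hK : ContinuousOn K (T ×ˢ Ψ))
    (hfK : ∀ w : Obs p, w.2 ∈ T → ∀ ψ ∈ Ψ, |f w ψ| ≤ K (w.2, ψ) * (1 + w.1 ^ 2)⁻¹) :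
    HasDecay T Ψ f := by
  obtain ⟨C, hC⟩ := (hT.prod hΨ).exists_bound_of_continuousOn hK
  refine ⟨hf, C, fun w hw ψ hψ => (hfK w hw ψ hψ).trans ?_⟩
  gcongr
  exact (le_abs_self _).trans (hC (w.2, ψ) ⟨hw, hψ⟩)

variable {γ : ℝ}

theorem hasDecay_gammaLik (hT : IsCompact T) (hTpos : ∀ z ∈ T, 0 < z.2) (hΨ : IsCompact Ψ)
    (hΨpos : ∀ ψ ∈ Ψ, 0 < ψ.2) (hγ : 0 < γ) :
    HasDecay T Ψ fun w ψ => gammaLik γ w.1 w.2.1 w.2.2 ψ :=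
  hasDecay_of_abs_le (K := fun q => 1 / γ * envelope γ q.1.1 q.1.2 q.2) hT hΨ
    ((continuousOn_gammaLik hγ).mono fun _ hq => add_pos (hΨpos _ hq.2) (hTpos _ hq.1))
    ((continuousOn_envelope.mono fun _ hq =>
      add_pos (hΨpos _ hq.2) (hTpos _ hq.1)).const_mul _)
    fun _ hw ψ hψ => abs_gammaLik_le hγ (add_pos (hΨpos ψ hψ) (hTpos _ hw)) _ _

theorem hasDecay_varTerm (hT : IsCompact T) (hTpos : ∀ z ∈ T, 0 < z.2) (hΨ : IsCompact Ψ)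
    (hΨpos : ∀ ψ ∈ Ψ, 0 < ψ.2) (hγ : 0 < γ) :
    HasDecay T Ψ fun w ψ => varTerm γ w.1 w.2.1 w.2.2 ψ :=
  hasDecay_of_abs_le (K := fun q => 2 * (q.2.2 + q.1.2) * envelope γ q.1.1 q.1.2 q.2) hT hΨ
    ((continuousOn_varTerm hγ.le).mono fun q hq => add_pos (hΨpos _ hq.2) (hTpos _ hq.1))
    (ContinuousOn.mul (by fun_prop) (continuousOn_envelope.mono fun q hq =>
      add_pos (hΨpos _ hq.2) (hTpos _ hq.1)))
    fun w hw ψ hψ => abs_varTerm_le hγ (hΨpos ψ hψ).le (hTpos _ hw) _ _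

end HasDecay

section CentralMass

variable {p : ℕ} {ν : Measure (Cov p × ℝ)} {T : Set (Cov p × ℝ)} {ψ₀ : Param p} {γ : ℝ}
  {δ : ℝ → ℝ}

/-- The mean of `1 / (1 + y²)` over contaminated observations, which measures how much of the
contamination is near the origin. -/
noncomputable def centralMass (ν : Measure (Cov p × ℝ)) (δ : ℝ → ℝ) : ℝ :=
  ∫ w, (1 + w.1 ^ 2)⁻¹ ∂contLaw ν δ

theorem integrable_inv_one_add_sq {F : Measure (Obs p)} [IsFiniteMeasure F] :
    Integrable (fun w => (1 + w.1 ^ 2)⁻¹) F := by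
  refine .of_bound (by fun_prop) 1 (.of_forall fun w => ?_)
  rw [Real.norm_of_nonneg (by positivity)]
  exact inv_le_one_of_one_le₀ (le_add_of_nonneg_right (sq_nonneg _))

theorem abs_integral_contLaw_le [IsFiniteMeasure (contLaw ν δ)] {f : Obs p → ℝ} {C : ℝ}
    (hf : ∀ᵐ w ∂contLaw ν δ, |f w| ≤ C * (1 + w.1 ^ 2)⁻¹) :
    |∫ w, f w ∂contLaw ν δ| ≤ C * centralMass ν δ := by
  rw [centralMass, ← integral_const_mul, ← Real.norm_eq_abs]
  exact norm_integral_le_of_norm_le (integrable_inv_one_add_sq.const_mul C) hf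

theorem exists_inv_one_add_sq_le (hT : IsCompact T) (hTpos : ∀ z ∈ T, 0 < z.2) (hA : 0 ≤ ψ₀.2)
    {ε : ℝ} (hε : 0 < ε) :
    ∃ c, 0 < c ∧ ∀ z ∈ T, ∀ y : ℝ,
      (1 + y ^ 2)⁻¹ ≤ ε + c * phi y (inner ℝ z.1 ψ₀.1) (ψ₀.2 + z.2) ^ γ := by
  have hφpos : ∀ q ∈ Set.Icc (-ε⁻¹) ε⁻¹ ×ˢ T,
      0 < phi q.1 (inner ℝ q.2.1 ψ₀.1) (ψ₀.2 + q.2.2) :=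
    fun q hq => phi_pos (add_pos_of_nonneg_of_pos hA (hTpos _ hq.2)) _ _
  have hφcont : ContinuousOn
      (fun q : Obs p => phi q.1 (inner ℝ q.2.1 ψ₀.1) (ψ₀.2 + q.2.2) ^ γ)
      (Set.Icc (-ε⁻¹) ε⁻¹ ×ˢ T) :=
    (continuousOn_phi.comp (f := fun q : Obs p =>
      (q.1, (inner ℝ q.2.1 ψ₀.1 : ℝ), ψ₀.2 + q.2.2)) (by fun_prop)
      fun q hq => add_pos_of_nonneg_of_pos hA (hTpos _ hq.2)).rpow_const
      fun q hq => .inl (hφpos q hq).ne'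
  obtain ⟨c, hc, hle⟩ := (isCompact_Icc.prod hT).exists_forall_le' hφcont
    (a := 0) fun q hq => Real.rpow_pos_of_pos (hφpos q hq) γ
  refine ⟨c⁻¹, by positivity, fun z hz y => ?_⟩
  rcases le_or_gt |y| ε⁻¹ with hy | hy
  · calc (1 + y ^ 2)⁻¹ ≤ 1 := inv_le_one_of_one_le₀ (le_add_of_nonneg_right (sq_nonneg y))
      _ ≤ c⁻¹ * phi y (inner ℝ z.1 ψ₀.1) (ψ₀.2 + z.2) ^ γ := by
          rw [inv_mul_eq_div, one_le_div hc]
          exact hle (y, z) ⟨abs_le.1 hy, hz⟩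
      _ ≤ _ := le_add_of_nonneg_left hε.le
  · calc (1 + y ^ 2)⁻¹ ≤ ε := by
          rw [inv_le_comm₀ (by positivity) hε]
          nlinarith [sq_abs y, sq_nonneg (|y| - 1)]
      _ ≤ _ := le_add_of_nonneg_right
        (mul_nonneg (by positivity) (Real.rpow_nonneg (phi_nonneg _ _ _) _))

theorem lintegral_margDensity_mul_inv_le (hδ : IsProbDensity δ) {D ε c : ℝ} (hD : 0 < D)
    (hε : 0 ≤ ε) (hc : 0 ≤ c) {g : ℝ → ℝ} (hg : Measurable g) (hg₀ : ∀ y, 0 ≤ g y)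
    (hle : ∀ y, (1 + y ^ 2)⁻¹ ≤ ε + c * g y) :
    ∫⁻ y, margDensity δ D y * ENNReal.ofReal (1 + y ^ 2)⁻¹ ≤
      ENNReal.ofReal ε +
        ENNReal.ofReal c * ∫⁻ y, margDensity δ D y * ENNReal.ofReal (g y) := by
  have hδm := hδ.measurable
  calc ∫⁻ y, margDensity δ D y * ENNReal.ofReal (1 + y ^ 2)⁻¹
      ≤ ∫⁻ y, (margDensity δ D y * ENNReal.ofReal ε +
          ENNReal.ofReal c * (margDensity δ D y * ENNReal.ofReal (g y))) := by
        refine lintegral_mono fun y => ?_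
        rw [mul_left_comm, ← ENNReal.ofReal_mul hc, ← mul_add,
          ← ENNReal.ofReal_add hε (mul_nonneg hc (hg₀ y))]
        gcongr
        exact hle y
    _ = _ := by
        rw [lintegral_add_left (by fun_prop), lintegral_mul_const _ (by fun_prop),
          lintegral_margDensity hδ hD, one_mul, lintegral_const_mul _ (by fun_prop)]

theorem exists_centralMass_le_of_rho_le [IsProbabilityMeasure ν] {X : Set (Cov p)} {DL DU : ℝ}
    (hDL : 0 < DL) (hD : ∀ᵐ z ∂ν, z.2 ∈ Set.Icc DL DU) (hX : Bornology.IsBounded X)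
    (hxX : ∀ᵐ z ∂ν, z.1 ∈ X) (hA : 0 ≤ ψ₀.2) {ε : ℝ} (hε : 0 < ε) :
    ∃ ρ₀, 0 < ρ₀ ∧ ∀ δ, IsProbDensity δ → rho X DL DU ψ₀ γ δ ≤ ENNReal.ofReal ρ₀ →
      centralMass ν δ ≤ ε := by
  obtain ⟨c, hc, hle⟩ := exists_inv_one_add_sq_le (T := closure X ×ˢ Set.Icc DL DU) (γ := γ)
    (hX.isCompact_closure.prod isCompact_Icc) (fun z hz => hDL.trans_le hz.2.1) hA (half_pos hε)
  refine ⟨ε / 2 / c, by positivity, fun δ hδ hρ => ?_⟩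
  have hδm := hδ.measurable
  have hinner : ∀ᵐ z ∂ν, ∫⁻ y, margDensity δ z.2 y * ENNReal.ofReal (1 + y ^ 2)⁻¹ ≤
      ENNReal.ofReal ε := by
    filter_upwards [hD, hxX] with z hzD hzX
    have hk : ∫⁻ y, margDensity δ z.2 y *
        ENNReal.ofReal (phi y (inner ℝ z.1 ψ₀.1) (ψ₀.2 + z.2) ^ γ) ≤
          ENNReal.ofReal (ε / 2 / c) := by
      refine le_trans ?_ hρ
      exact le_iSup₂_of_le 0 (by simp) <| le_iSup₂_of_le z.2 hzD <| le_iSup₂_of_le z.1 hzX <| by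
        simp only [pow_zero, mul_one, le_refl]
    calc ∫⁻ y, margDensity δ z.2 y * ENNReal.ofReal (1 + y ^ 2)⁻¹
        ≤ ENNReal.ofReal (ε / 2) + ENNReal.ofReal c * ENNReal.ofReal (ε / 2 / c) :=
          (lintegral_margDensity_mul_inv_le hδ (hDL.trans_le hzD.1) (half_pos hε).le hc.le
            (by fun_prop) (fun y => Real.rpow_nonneg (phi_nonneg _ _ _) _)
            (hle z ⟨subset_closure hzX, hzD⟩)).trans (by gcongr)
      _ = ENNReal.ofReal ε := by
          rw [← ENNReal.ofReal_mul hc.le, ← ENNReal.ofReal_add (by positivity) (by positivity),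
            mul_div_cancel₀ _ hc.ne', add_halves]
  rw [centralMass, integral_eq_lintegral_of_nonneg_ae (.of_forall fun w => by positivity)
    (by fun_prop), contLaw, lintegral_densityLaw (by fun_prop) (by fun_prop)]
  exact ENNReal.toReal_le_of_le_ofReal hε.le ((lintegral_mono_ae hinner).trans (by simp))

end CentralMass

section LawOfLargeNumbers

variable {Ω E B A : Type*} [MeasurableSpace Ω] [MeasurableSpace E] {Z : ℕ → Ω → E}
  {F : Measure E} {P : Measure Ω}

/-- The random elements `Z 0, Z 1, …` are independent with common law `F`. -/
structure IsIIDSample (Z : ℕ → Ω → E) (F : Measure E) (P : Measure Ω) : Prop where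
  iIndepFun : iIndepFun Z P
  hasLaw : ∀ i, HasLaw (Z i) F P

/-- The sample mean of `f` over the first `m` points of `z`; it is `0` for `m = 0`. -/
noncomputable def empiricalMean [AddCommMonoid B] [Module ℝ B] (m : ℕ) (z : ℕ → E) (f : E → B) :
    B :=
  (m : ℝ)⁻¹ • ∑ i ∈ Finset.range m, f (z i)

theorem empiricalMean_le_add {α : Type*} {f g : α → ℝ} {m : ℕ} {z : ℕ → α} {ε : ℝ} (hε : 0 ≤ ε)
    (h : ∀ i, f (z i) ≤ g (z i) + ε) : empiricalMean m z f ≤ empiricalMean m z g + ε := by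
  have hsum : ∑ i ∈ Finset.range m, f (z i) ≤ ∑ i ∈ Finset.range m, g (z i) + m * ε := by
    simpa [Finset.sum_add_distrib] using Finset.sum_le_sum fun i (_ : i ∈ Finset.range m) => h i
  calc (m : ℝ)⁻¹ * ∑ i ∈ Finset.range m, f (z i)
      ≤ (m : ℝ)⁻¹ * (∑ i ∈ Finset.range m, g (z i) + m * ε) := by gcongr
    _ = (m : ℝ)⁻¹ * ∑ i ∈ Finset.range m, g (z i) + (m : ℝ)⁻¹ * m * ε := by ring
    _ ≤ _ := by
        gcongr
        · exact le_rfl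
        · exact mul_le_of_le_one_left hε inv_mul_le_one

theorem IsIIDSample.ae_tendsto_empiricalMean [NormedAddCommGroup B] [NormedSpace ℝ B]
    [CompleteSpace B] (hZ : IsIIDSample Z F P) {f : E → B} (hf : Integrable f F) :
    ∀ᵐ s ∂P, Tendsto (fun m => empiricalMean m (Z · s) f) atTop (𝓝 (∫ w, f w ∂F)) := by
  borelize B
  have hmap (i : ℕ) : P.map (Z i) = F := (hZ.hasLaw i).map_eq
  have hfm : AEMeasurable f F := hf.aestronglyMeasurable.aemeasurable
  have hmean : ∫ s, f (Z 0 s) ∂P = ∫ w, f w ∂F :=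
    (hZ.hasLaw 0).integral_comp hf.aestronglyMeasurable
  rw [← hmean]
  exact strong_law_ae (fun i s => f (Z i s))
    (((hmap 0).symm ▸ hf).comp_aemeasurable (hZ.hasLaw 0).aemeasurable)
    (fun i j hij => (hZ.iIndepFun.indepFun hij).comp₀ (hZ.hasLaw i).aemeasurable
      (hZ.hasLaw j).aemeasurable ((hmap i).symm ▸ hfm) ((hmap j).symm ▸ hfm))
    fun i => ((hZ.hasLaw i).identDistrib (hZ.hasLaw 0)).comp_of_aemeasurable
      ((hmap i).symm ▸ hfm)

theorem IsIIDSample.ae_forall_mem (hZ : IsIIDSample Z F P) {S : Set E} (hS : MeasurableSet S)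
    (hF : ∀ᵐ w ∂F, w ∈ S) : ∀ᵐ s ∂P, ∀ i, Z i s ∈ S :=
  ae_all_iff.2 fun i => ((hZ.hasLaw i).ae_iff hS.mem).2 hF

variable [TopologicalSpace E] [SecondCountableTopology E] [BorelSpace E] [TopologicalSpace A]
  {S : Set E} {K : Set A} {f : E → A → ℝ} {C : ℝ}

/-- The strong law in the Banach space `C(K, ℝ)` is a uniform strong law. -/
theorem IsIIDSample.ae_tendstoUniformlyOn_empiricalMean [IsFiniteMeasure F]
    (hZ : IsIIDSample Z F P) (hS : MeasurableSet S) (hFS : ∀ᵐ w ∂F, w ∈ S) (hK : IsCompact K)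
    (hf : ContinuousOn (Function.uncurry f) (S ×ˢ K)) (hfC : ∀ w ∈ S, ∀ k ∈ K, |f w k| ≤ C) :
    ∀ᵐ s ∂P, TendstoUniformlyOn (fun m k => empiricalMean m (Z · s) (f · k))
      (fun k => ∫ w, f w k ∂F) atTop K := by
  have := isCompact_iff_compactSpace.1 hK
  let g : C(S × K, ℝ) := ⟨fun q => f q.1 q.2,
    hf.comp_continuous (f := fun q : S × K => ((q.1 : E), (q.2 : A))) (by fun_prop)
      fun q => ⟨q.1.2, q.2.2⟩⟩
  let Φ : E → C(K, ℝ) := Function.extend Subtype.val g.curry 0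
  have hΦ : ∀ w ∈ S, ∀ k : K, Φ w k = f w k := fun w hw k => by
    rw [show Φ w = g.curry ⟨w, hw⟩ from Subtype.val_injective.extend_apply _ _ ⟨w, hw⟩]
    rfl
  have hΦint : Integrable Φ F := by
    refine .of_bound ((MeasurableEmbedding.subtype_coe hS).stronglyMeasurable_extend
      g.curry.continuous.stronglyMeasurable stronglyMeasurable_zero).aestronglyMeasurable |C| ?_
    filter_upwards [hFS] with w hw
    refine (ContinuousMap.norm_le _ (abs_nonneg C)).2 fun k => ?_
    rw [hΦ w hw, Real.norm_eq_abs]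
    exact (hfC w hw k k.2).trans (le_abs_self C)
  have hmean (k : K) : (∫ w, Φ w ∂F) k = ∫ w, f w k ∂F :=
    (ContinuousLinearMap.integral_comp_comm (ContinuousMap.evalCLM ℝ k) hΦint).symm.trans
      (integral_congr_ae (hFS.mono fun w hw => hΦ w hw k))
  filter_upwards [hZ.ae_tendsto_empiricalMean hΦint, hZ.ae_forall_mem hS hFS] with s hs hsS
  rw [tendstoUniformlyOn_iff_tendstoUniformly_comp_coe]
  convert ContinuousMap.tendsto_iff_tendstoUniformly.1 hs using 1
  · ext m k
    simp [empiricalMean, hΦ _ (hsS _)]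
  · ext k
    exact (hmean k).symm

end LawOfLargeNumbers

section Population

variable {p : ℕ} {ν : Measure (Cov p × ℝ)} {γ : ℝ} {ψ ψ₀ : Param p}

theorem eq_of_ae_inner_eq {α : Type*} [MeasurableSpace α] {μ : Measure α} {x : α → Cov p}
    (hx : MemLp x 2 μ) (hdet : (Matrix.of fun j k => ∫ a, x a j * x a k ∂μ).det ≠ 0)
    {β β' : Cov p} (h : ∀ᵐ a ∂μ, (inner ℝ (x a) β : ℝ) = inner ℝ (x a) β') : β = β' := by
  have hcoord (j : Fin p) : MemLp (fun a => x a j) 2 μ :=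
    (EuclideanSpace.proj (𝕜 := ℝ) j).comp_memLp' hx
  have hprod (j k : Fin p) : Integrable (fun a => x a j * x a k) μ :=
    (hcoord j).integrable_mul (hcoord k)
  have hker : (Matrix.of fun j k => ∫ a, x a j * x a k ∂μ).mulVec (fun k => (β - β') k) = 0 := by
    ext j
    simp only [Matrix.mulVec, dotProduct, Matrix.of_apply, Pi.zero_apply, ← integral_mul_const]
    rw [← integral_finsetSum _ fun k _ => (hprod j k).mul_const _]
    refine integral_eq_zero_of_ae (h.mono fun a ha => ?_)
    have horth : ∑ k, x a k * (β - β') k = 0 := by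
      rw [← sub_eq_zero, ← inner_sub_right, PiLp.inner_apply] at ha
      simpa only [RCLike.inner_apply, conj_trivial, mul_comm] using ha
    simp only [mul_assoc, ← Finset.mul_sum, horth, mul_zero, Pi.zero_apply]
  have hzero := Matrix.eq_zero_of_mulVec_eq_zero hdet hker
  ext k
  exact sub_eq_zero.1 (congrFun hzero k)

theorem integral_gammaLik_lt [IsProbabilityMeasure ν] (hν : ∀ᵐ z ∂ν, 0 < z.2)
    (hx : MemLp Prod.fst 2 ν) (hdet : (Matrix.of fun j k => ∫ z, z.1 j * z.1 k ∂ν).det ≠ 0)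
    (hγ : 0 < γ) (hA : 0 < ψ.2) (hA₀ : 0 < ψ₀.2) (hne : ψ ≠ ψ₀)
    (hint : Integrable (fun w => gammaLik γ w.1 w.2.1 w.2.2 ψ) (coreLaw ν ψ₀))
    (hint₀ : Integrable (fun w => gammaLik γ w.1 w.2.1 w.2.2 ψ₀) (coreLaw ν ψ₀)) :
    ∫ w, gammaLik γ w.1 w.2.1 w.2.2 ψ ∂coreLaw ν ψ₀ <
      ∫ w, gammaLik γ w.1 w.2.1 w.2.2 ψ₀ ∂coreLaw ν ψ₀ := by
  have hi := integrable_integral_gaussianReal hν hA₀.le hint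
  have hi₀ := integrable_integral_gaussianReal hν hA₀.le hint₀
  rw [integral_coreLaw hν hA₀.le hint, integral_coreLaw hν hA₀.le hint₀]
  simp only [gammaLik, if_neg hγ.ne', integral_const_mul] at hi hi₀ ⊢
  rw [← integral_const_mul, ← integral_const_mul]
  have hlt (z : Cov p × ℝ) (hz : 0 < z.2)
      (hne : inner ℝ z.1 ψ.1 ≠ (inner ℝ z.1 ψ₀.1 : ℝ) ∨ ψ.2 ≠ ψ₀.2) :=
    mul_lt_mul_of_pos_left (integral_gaussianReal_weight_lt hγ (add_pos hA hz) (add_pos hA₀ hz) hne)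
      (one_div_pos.2 hγ)
  have hle : ∀ᵐ z ∂ν,
      1 / γ * ∫ y, weight γ y z.1 z.2 ψ
        ∂gaussianReal (inner ℝ z.1 ψ₀.1) (ψ₀.2 + z.2).toNNReal ≤
      1 / γ * ∫ y, weight γ y z.1 z.2 ψ₀
        ∂gaussianReal (inner ℝ z.1 ψ₀.1) (ψ₀.2 + z.2).toNNReal := by
    filter_upwards [hν] with z hz
    by_cases heq : inner ℝ z.1 ψ.1 = (inner ℝ z.1 ψ₀.1 : ℝ) ∧ ψ.2 = ψ₀.2
    · simp only [weight, heq.1, heq.2, le_refl]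
    · exact (hlt z hz (not_and_or.1 heq)).le
  refine lt_of_le_of_ne (integral_mono_ae hi hi₀ hle) fun heq => hne ?_
  have hident : ∀ᵐ z ∂ν, (inner ℝ z.1 ψ.1 : ℝ) = inner ℝ z.1 ψ₀.1 ∧ ψ.2 = ψ₀.2 := by
    filter_upwards [hν, (integral_eq_iff_of_ae_le hi hi₀ hle).1 heq] with z hz hzeq
    by_contra hcon
    exact (hlt z hz (not_and_or.1 hcon)).ne hzeq
  obtain ⟨z, hz⟩ := hident.exists
  exact Prod.ext (eq_of_ae_inner_eq hx hdet (hident.mono fun _ h => h.1)) hz.2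

end Population

theorem exists_forall_isMaxOn_lt {A : Type*} [TopologicalSpace A] {K : Set A} (hK : IsCompact K)
    {H V : A → ℝ} (hH : ContinuousOn H K) (hV : ContinuousOn V K) {a₀ : A} (ha₀ : a₀ ∈ K)
    (hmax : ∀ a ∈ K, a ≠ a₀ → H a < H a₀) {κ : ℝ} (hκ : 0 < κ) :
    ∃ η, 0 < η ∧ ∀ H' V' : A → ℝ, (∀ a ∈ K, |H' a - H a| ≤ η) → (∀ a ∈ K, |V' a - V a| ≤ η) →
      ∀ a ∈ K, IsMaxOn H' K a → V' a < V a₀ + κ := by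
  have hcompact : IsCompact (K ∩ V ⁻¹' Set.Ici (V a₀ + κ / 2)) := by
    obtain ⟨F, hF, hKF⟩ :=
      continuousOn_iff_isClosed.1 hV (Set.Ici (V a₀ + κ / 2)) isClosed_Ici
    rw [Set.inter_comm, hKF]
    exact hK.inter_left hF
  obtain ⟨c, hc, hgap⟩ := hcompact.exists_forall_le' (a := 0)
    (continuousOn_const.sub (hH.mono Set.inter_subset_left) : ContinuousOn (fun a => H a₀ - H a) _)
    fun a ha => sub_pos.2 <| hmax a ha.1 <| by
      rintro rfl
      have : V a + κ / 2 ≤ V a := ha.2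
      linarith
  refine ⟨min (c / 3) (κ / 2), by positivity, fun H' V' hH' hV' a ha hmax' => ?_⟩
  have hnear : H a₀ - H a < c := by
    have h₀ := abs_le.1 ((hH' a₀ ha₀).trans (min_le_left _ _))
    have h := abs_le.1 ((hH' a ha).trans (min_le_left _ _))
    have hle : H' a₀ ≤ H' a := hmax' ha₀
    linarith
  have hVa : V a < V a₀ + κ / 2 := by
    by_contra! hle
    exact hnear.not_ge (hgap a ⟨ha, hle⟩)
  have h := abs_le.1 ((hV' a ha).trans (min_le_right _ _))
  linarith

section MarginalLikelihood

variable {p : ℕ} {T : Set (Cov p × ℝ)} {Ψ : Set (Param p)} {ψ ψ₀ : Param p} {D ε : ℝ}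

theorem le_quadratic {a b c d M : ℝ} (hc : 0 < c) (hca : c ≤ a) (hb : |b| ≤ M) (hd : |d| ≤ M)
    (y : ℝ) : c / 2 * y ^ 2 - (M ^ 2 / (2 * c) + M) ≤ a * y ^ 2 + b * y + d := by
  have hsquare : 0 ≤ (c * |y| - M) ^ 2 / (2 * c) := by positivity
  have hexpand : (c * |y| - M) ^ 2 / (2 * c) =
      c / 2 * y ^ 2 - M * |y| + M ^ 2 / (2 * c) := by
    rw [← sq_abs y]
    field_simp
    ring
  have hlin : -(M * |y|) ≤ b * y := by
    rw [neg_le, ← neg_mul]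
    calc -b * y ≤ |-b * y| := le_abs_self _
      _ = |b| * |y| := by rw [abs_mul, abs_neg]
      _ ≤ M * |y| := by gcongr
  linarith [mul_le_mul_of_nonneg_right hca (sq_nonneg y), neg_abs_le d]

theorem gammaLik_zero_sub (hV : 0 < ψ.2 + D) (hV₀ : 0 < ψ₀.2 + D) (y : ℝ) (x : Cov p) :
    gammaLik 0 y x D ψ₀ - gammaLik 0 y x D ψ =
      ((ψ.2 + D)⁻¹ - (ψ₀.2 + D)⁻¹) / 2 * y ^ 2 +
        (inner ℝ x ψ₀.1 * (ψ₀.2 + D)⁻¹ - inner ℝ x ψ.1 * (ψ.2 + D)⁻¹) * y +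
          (inner ℝ x ψ.1 ^ 2 * (ψ.2 + D)⁻¹ - inner ℝ x ψ₀.1 ^ 2 * (ψ₀.2 + D)⁻¹ +
            Real.log (2 * Real.pi * (ψ.2 + D)) - Real.log (2 * Real.pi * (ψ₀.2 + D))) / 2 := by
  rw [gammaLik_zero hV, gammaLik_zero hV₀]
  field_simp
  ring

/-- Too small a variance is penalised quadratically in `y`. -/
theorem exists_le_gammaLik_zero_sub (hT : IsCompact T) (hTpos : ∀ z ∈ T, 0 < z.2)
    (hΨ : IsCompact Ψ) (hΨpos : ∀ ψ ∈ Ψ, 0 < ψ.2) (hA₀ : 0 < ψ₀.2)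
    (hlt : ∀ ψ ∈ Ψ, ψ.2 < ψ₀.2) :
    ∃ c, 0 < c ∧ ∃ C, ∀ w : Obs p, w.2 ∈ T → ∀ ψ ∈ Ψ,
      c * w.1 ^ 2 - C ≤ gammaLik 0 w.1 w.2.1 w.2.2 ψ₀ - gammaLik 0 w.1 w.2.1 w.2.2 ψ := by
  let V (q : (Cov p × ℝ) × Param p) : ℝ := q.2.2 + q.1.2
  let V₀ (q : (Cov p × ℝ) × Param p) : ℝ := ψ₀.2 + q.1.2
  have hV : ∀ q ∈ T ×ˢ Ψ, 0 < V q := fun q hq => add_pos (hΨpos _ hq.2) (hTpos _ hq.1)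
  have hV₀ : ∀ q ∈ T ×ˢ Ψ, 0 < V₀ q := fun q hq => add_pos hA₀ (hTpos _ hq.1)
  have hinv : ContinuousOn (fun q => (V q)⁻¹) (T ×ˢ Ψ) :=
    ContinuousOn.inv₀ (by fun_prop) fun q hq => (hV q hq).ne'
  have hinv₀ : ContinuousOn (fun q => (V₀ q)⁻¹) (T ×ˢ Ψ) :=
    ContinuousOn.inv₀ (by fun_prop) fun q hq => (hV₀ q hq).ne'
  have hlog : ContinuousOn (fun q => Real.log (2 * Real.pi * V q)) (T ×ˢ Ψ) :=
    ContinuousOn.log (by fun_prop) fun q hq => by have := hV q hq; positivity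
  have hlog₀ : ContinuousOn (fun q => Real.log (2 * Real.pi * V₀ q)) (T ×ˢ Ψ) :=
    ContinuousOn.log (by fun_prop) fun q hq => by have := hV₀ q hq; positivity
  obtain ⟨c, hc, ha⟩ := (hT.prod hΨ).exists_forall_le' (a := 0)
    (f := fun q => ((V q)⁻¹ - (V₀ q)⁻¹) / 2) (by fun_prop) fun q hq =>
      half_pos (sub_pos.2 (inv_strictAnti₀ (hV q hq) (add_lt_add_left (hlt _ hq.2) _)))
  obtain ⟨B, hB⟩ := (hT.prod hΨ).exists_bound_of_continuousOn
    (f := fun q => inner ℝ q.1.1 ψ₀.1 * (V₀ q)⁻¹ - inner ℝ q.1.1 q.2.1 * (V q)⁻¹)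
    (by fun_prop)
  obtain ⟨M, hM⟩ := (hT.prod hΨ).exists_bound_of_continuousOn
    (f := fun q => (inner ℝ q.1.1 q.2.1 ^ 2 * (V q)⁻¹ - inner ℝ q.1.1 ψ₀.1 ^ 2 * (V₀ q)⁻¹ +
      Real.log (2 * Real.pi * V q) - Real.log (2 * Real.pi * V₀ q)) / 2) (by fun_prop)
  refine ⟨c / 2, half_pos hc, max B M ^ 2 / (2 * c) + max B M, fun w hw ψ hψ => ?_⟩
  have hq : (w.2, ψ) ∈ T ×ˢ Ψ := ⟨hw, hψ⟩
  rw [gammaLik_zero_sub (hV _ hq) (hV₀ _ hq)]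
  exact le_quadratic hc (ha _ hq) ((hB _ hq).trans (le_max_left _ _))
    ((hM _ hq).trans (le_max_right _ _)) w.1

theorem exists_sub_lt_of_isEstimate_zero (hT : IsCompact T) (hTpos : ∀ z ∈ T, 0 < z.2)
    (hΨ : IsCompact Ψ) (hΨpos : ∀ ψ ∈ Ψ, 0 < ψ.2) (hψ₀ : ψ₀ ∈ Ψ) (hε : 0 < ε) :
    ∃ R, ∀ (m : ℕ) (z : ℕ → Obs p), (∀ i, (z i).2 ∈ T) →
      R < empiricalMean m z (fun w => w.1 ^ 2) → ∀ ψ,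
        IsEstimate Ψ 0 m (fun i => (z i).1) (fun i => (z i).2.1) (fun i => (z i).2.2) ψ →
          ψ₀.2 - ε < ψ.2 := by
  obtain ⟨c, hc, C, hgap⟩ := exists_le_gammaLik_zero_sub hT hTpos
    (hΨ.inter_right (isClosed_Iic.preimage continuous_snd : IsClosed (Prod.snd ⁻¹' Set.Iic _)))
    (fun ψ hψ => hΨpos ψ hψ.1) (hΨpos _ hψ₀)
    fun ψ hψ => hψ.2.trans_lt (sub_lt_self _ hε)
  refine ⟨|C| / c, fun m z hz hR ψ hψ => ?_⟩
  by_contra! hle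
  have hm : (0 : ℝ) < m := by
    refine Nat.cast_pos.2 (Nat.pos_of_ne_zero ?_)
    rintro rfl
    simp only [empiricalMean, Finset.range_zero, Finset.sum_empty, smul_zero] at hR
    exact hR.not_ge (by positivity)
  have hmax : ∑ i ∈ Finset.range m, gammaLik 0 (z i).1 (z i).2.1 (z i).2.2 ψ₀ ≤
      ∑ i ∈ Finset.range m, gammaLik 0 (z i).1 (z i).2.1 (z i).2.2 ψ := hψ.2 hψ₀
  have hsum := Finset.sum_le_sum fun i (_ : i ∈ Finset.range m) => hgap (z i) (hz i) ψ ⟨hψ.1, hle⟩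
  rw [Finset.sum_sub_distrib, Finset.sum_sub_distrib, ← Finset.mul_sum, Finset.sum_const,
    Finset.card_range, nsmul_eq_mul] at hsum
  rw [empiricalMean, smul_eq_mul, lt_inv_mul_iff₀ hm, mul_div_assoc', div_lt_iff₀' hc] at hR
  linarith [mul_le_mul_of_nonneg_left (le_abs_self C) hm.le]

theorem varTerm_zero_le_add (hA₀ : 0 < ψ₀.2) (hA : 0 < ψ.2) (hD : 0 < D) (hε : 0 ≤ ε)
    (h : ψ₀.2 - ε ≤ ψ.2) (y : ℝ) (x : Cov p) :
    varTerm 0 y x D ψ₀ ≤ varTerm 0 y x D ψ + ε := by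
  rw [varTerm_zero (by positivity), varTerm_zero (by positivity)]
  have hdiff : D ^ 2 / (ψ.2 + D) - D ^ 2 / (ψ₀.2 + D) =
      D ^ 2 * (ψ₀.2 - ψ.2) / ((ψ.2 + D) * (ψ₀.2 + D)) := by
    field_simp
    ring
  have hle : D ^ 2 * (ψ₀.2 - ψ.2) / ((ψ.2 + D) * (ψ₀.2 + D)) ≤ ε := by
    rw [div_le_iff₀' (by positivity)]
    calc D ^ 2 * (ψ₀.2 - ψ.2) ≤ D * D * ε := by
          rw [sq]
          gcongr
          linarith
      _ ≤ (ψ.2 + D) * (ψ₀.2 + D) * ε := by gcongr <;> linarith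
  linarith

end MarginalLikelihood

section FarContamination

universe u

variable {p : ℕ} {ν : Measure (Cov p × ℝ)} {ω η : ℝ} {ψ₀ : Param p}
  {T : Set (Cov p × ℝ)} {Ψ : Set (Param p)} {E E' : ℕ → (ℕ → Obs p) → Prop}

/-- The property `E m z` of the first `m` points of a sequence `z` of observations holds almost
surely for all large `m`, along every i.i.d. sample of the contaminated model whose contamination
is far enough from the origin, uniformly over such contaminations. -/
def EventuallyFar (ν : Measure (Cov p × ℝ)) (ω : ℝ) (ψ₀ : Param p)
    (E : ℕ → (ℕ → Obs p) → Prop) : Prop :=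
  ∃ e, 0 < e ∧ ∀ δ, IsProbDensity δ → centralMass ν δ ≤ e →
    ∀ (Ω : Type u) [MeasurableSpace Ω] (P : Measure Ω) (Z : ℕ → Ω → Obs p),
      IsIIDSample Z (obsLaw ν ω ψ₀ δ) P → ∀ᵐ s ∂P, ∀ᶠ m in atTop, E m (Z · s)

theorem EventuallyFar.mono (hE : EventuallyFar.{u} ν ω ψ₀ E) (h : ∀ m z, E m z → E' m z) :
    EventuallyFar.{u} ν ω ψ₀ E' := by
  obtain ⟨e, he, hE⟩ := hE
  refine ⟨e, he, fun δ hδ hδe Ω _ P Z hZ => ?_⟩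
  filter_upwards [hE δ hδ hδe Ω P Z hZ] with s hs using hs.mono fun m => h m _

theorem EventuallyFar.and (hE : EventuallyFar.{u} ν ω ψ₀ E) (hE' : EventuallyFar.{u} ν ω ψ₀ E') :
    EventuallyFar.{u} ν ω ψ₀ fun m z => E m z ∧ E' m z := by
  obtain ⟨e, he, hE⟩ := hE
  obtain ⟨e', he', hE'⟩ := hE'
  refine ⟨min e e', lt_min he he', fun δ hδ hδe Ω _ P Z hZ => ?_⟩
  filter_upwards [hE δ hδ (hδe.trans (min_le_left _ _)) Ω P Z hZ,
    hE' δ hδ (hδe.trans (min_le_right _ _)) Ω P Z hZ] with s hs hs' using hs.and hs'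

variable [IsProbabilityMeasure ν]

theorem eventuallyFar_forall_mem (hT : MeasurableSet T) (hTpos : ∀ z ∈ T, 0 < z.2)
    (hνT : ∀ᵐ z ∂ν, z ∈ T) (hA : 0 < ψ₀.2) (hω : ω ∈ Set.Icc (0 : ℝ) 1) :
    EventuallyFar ν ω ψ₀ fun _ z => ∀ i, (z i).2 ∈ T := by
  refine ⟨1, one_pos, fun δ hδ _ Ω _ P Z hZ => ?_⟩
  have hobsT : ∀ᵐ w ∂obsLaw ν ω ψ₀ δ, w.2 ∈ T :=
    (measurePreserving_snd_obsLaw (hνT.mono hTpos) hA hδ hω).quasiMeasurePreserving.ae hνT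
  filter_upwards [hZ.ae_forall_mem (measurable_snd hT) hobsT] with s hs using .of_forall fun _ => hs

theorem HasDecay.eventuallyFar_abs_empiricalMean_sub_le {f : Obs p → Param p → ℝ}
    (hf : HasDecay T Ψ f) (hT : MeasurableSet T) (hTpos : ∀ z ∈ T, 0 < z.2)
    (hνT : ∀ᵐ z ∂ν, z ∈ T) (hΨ : IsCompact Ψ) (hA : 0 < ψ₀.2) (hω : ω ∈ Set.Icc (0 : ℝ) 1)
    (hη : 0 < η) :
    EventuallyFar ν ω ψ₀ fun m z => ∀ ψ ∈ Ψ,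
      |empiricalMean m z (f · ψ) - (1 - ω) * ∫ w, f w ψ ∂coreLaw ν ψ₀| ≤ η := by
  obtain ⟨C, hC⟩ := hf.exists_bound
  obtain ⟨B, hB⟩ := hf.exists_abs_le
  refine ⟨η / 2 / (|C| + 1), by positivity, fun δ hδ hδe Ω _ P Z hZ => ?_⟩
  have hν := hνT.mono hTpos
  have hcore := measurePreserving_snd_coreLaw hν hA.le
  have hcont := measurePreserving_snd_contLaw hν hδ
  have hobs := measurePreserving_snd_obsLaw hν hA hδ hω
  have := hcore.hasLaw.isProbabilityMeasure
  have := hcont.hasLaw.isProbabilityMeasure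
  have := hobs.hasLaw.isProbabilityMeasure
  have hcoreT : ∀ᵐ w ∂coreLaw ν ψ₀, w.2 ∈ T := hcore.quasiMeasurePreserving.ae hνT
  have hcontT : ∀ᵐ w ∂contLaw ν δ, w.2 ∈ T := hcont.quasiMeasurePreserving.ae hνT
  have hobsT : ∀ᵐ w ∂obsLaw ν ω ψ₀ δ, w.2 ∈ T := hobs.quasiMeasurePreserving.ae hνT
  have hcontamination (ψ : Param p) (hψ : ψ ∈ Ψ) : |∫ w, f w ψ ∂contLaw ν δ| ≤ η / 2 :=
    calc |∫ w, f w ψ ∂contLaw ν δ| ≤ (|C| + 1) * centralMass ν δ :=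
          abs_integral_contLaw_le <| hcontT.mono fun w hw => (hC w hw ψ hψ).trans <| by
            gcongr
            linarith [le_abs_self C]
      _ ≤ (|C| + 1) * (η / 2 / (|C| + 1)) := by gcongr
      _ = η / 2 := by field_simp
  have hbias (ψ : Param p) (hψ : ψ ∈ Ψ) :
      |∫ w, f w ψ ∂obsLaw ν ω ψ₀ δ - (1 - ω) * ∫ w, f w ψ ∂coreLaw ν ψ₀| ≤ η / 2 := by
    rw [integral_obsLaw hν hA hδ hω (hf.integrable hT hcoreT hψ) (hf.integrable hT hcontT hψ),
      add_sub_cancel_left, abs_mul, abs_of_nonneg hω.1]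
    exact (mul_le_of_le_one_left (abs_nonneg _) hω.2).trans (hcontamination ψ hψ)
  filter_upwards [hZ.ae_tendstoUniformlyOn_empiricalMean (measurable_snd hT) hobsT hΨ
    hf.continuousOn hB] with s hs
  filter_upwards [Metric.tendstoUniformlyOn_iff.1 hs _ (half_pos hη)] with m hm ψ hψ
  have hfluct := hm ψ hψ
  rw [dist_comm, Real.dist_eq] at hfluct
  calc _ ≤ η / 2 + η / 2 := (abs_sub_le _ _ _).trans (add_le_add hfluct.le (hbias ψ hψ))
    _ = η := add_halves η

theorem sub_mul_inv_one_add_le_min {t N : ℝ} (ht : 0 ≤ t) (hN : 0 ≤ N) :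
    N - N * (1 + N) * (1 + t)⁻¹ ≤ min t N := by
  refine le_min ?_ (sub_le_self _ (by positivity))
  rw [sub_le_iff_le_add, ← sub_le_iff_le_add', ← div_eq_mul_inv, le_div_iff₀ (by positivity)]
  nlinarith [sq_nonneg (N - t), mul_nonneg hN ht]

theorem integrable_min_sq {F : Measure (Obs p)} [IsFiniteMeasure F] {N : ℝ} (hN : 0 ≤ N) :
    Integrable (fun w => min (w.1 ^ 2) N) F :=
  .of_bound (by fun_prop) N <| .of_forall fun w => by
    rw [Real.norm_of_nonneg (le_min (sq_nonneg _) hN)]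
    exact min_le_right _ _

theorem mul_half_le_integral_min_sq_obsLaw {δ : ℝ → ℝ} (hν : ∀ᵐ z ∂ν, 0 < z.2) (hA : 0 < ψ₀.2)
    (hδ : IsProbDensity δ) (hω : ω ∈ Set.Icc (0 : ℝ) 1) {N : ℝ} (hN : 0 ≤ N)
    (hδN : centralMass ν δ ≤ (2 * (1 + N))⁻¹) :
    ω * (N / 2) ≤ ∫ w, min (w.1 ^ 2) N ∂obsLaw ν ω ψ₀ δ := by
  have := (measurePreserving_snd_coreLaw hν hA.le).hasLaw.isProbabilityMeasure
  have := (measurePreserving_snd_contLaw hν hδ).hasLaw.isProbabilityMeasure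
  have hcont : N / 2 ≤ ∫ w, min (w.1 ^ 2) N ∂contLaw ν δ := by
    have hlow : Integrable (fun w : Obs p => N - N * (1 + N) * (1 + w.1 ^ 2)⁻¹) (contLaw ν δ) :=
      (integrable_const N).sub (integrable_inv_one_add_sq.const_mul _)
    calc N / 2 = N - N * (1 + N) * (2 * (1 + N))⁻¹ := by
          field_simp
          ring
      _ ≤ N - N * (1 + N) * centralMass ν δ := by gcongr
      _ = ∫ w, (N - N * (1 + N) * (1 + w.1 ^ 2)⁻¹) ∂contLaw ν δ := by
          rw [integral_sub (integrable_const N) (integrable_inv_one_add_sq.const_mul _),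
            integral_const_mul, centralMass, integral_const, probReal_univ, one_smul]
      _ ≤ ∫ w, min (w.1 ^ 2) N ∂contLaw ν δ :=
          integral_mono hlow (integrable_min_sq hN) fun w =>
            sub_mul_inv_one_add_le_min (sq_nonneg _) hN
  rw [integral_obsLaw hν hA hδ hω (integrable_min_sq hN) (integrable_min_sq hN)]
  refine (mul_le_mul_of_nonneg_left hcont hω.1).trans (le_add_of_nonneg_left ?_)
  exact mul_nonneg (sub_nonneg.2 hω.2) (integral_nonneg fun w => le_min (sq_nonneg _) hN)

theorem eventuallyFar_lt_empiricalMean_sq (hν : ∀ᵐ z ∂ν, 0 < z.2) (hA : 0 < ψ₀.2)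
    (hω : ω ∈ Set.Ioc (0 : ℝ) 1) (R : ℝ) :
    EventuallyFar ν ω ψ₀ fun m z => R < empiricalMean m z (fun w => w.1 ^ 2) := by
  have hω₀ := hω.1
  set N := 2 * (|R| + 1) / ω with hNdef
  refine ⟨(2 * (1 + N))⁻¹, by positivity, fun δ hδ hδN Ω _ P Z hZ => ?_⟩
  have := (measurePreserving_snd_obsLaw hν hA hδ ⟨hω₀.le, hω.2⟩).hasLaw.isProbabilityMeasure
  have hR : R < ∫ w, min (w.1 ^ 2) N ∂obsLaw ν ω ψ₀ δ :=
    calc R < |R| + 1 := (le_abs_self R).trans_lt (lt_add_one _)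
      _ = ω * (N / 2) := by
          rw [hNdef]
          field_simp
      _ ≤ _ := mul_half_le_integral_min_sq_obsLaw hν hA hδ ⟨hω₀.le, hω.2⟩ (by positivity) hδN
  filter_upwards [hZ.ae_tendsto_empiricalMean (integrable_min_sq (N := N) (by positivity))]
    with s hs
  filter_upwards [hs.eventually_const_lt hR] with m hm
  have hle := empiricalMean_le_add (f := fun w : Obs p => min (w.1 ^ 2) N)
    (g := fun w => w.1 ^ 2) (m := m) (z := (Z · s)) le_rfl fun i => by simp
  linarith

end FarContamination

section Selection

variable {p : ℕ} {ν : Measure (Cov p × ℝ)} [IsProbabilityMeasure ν] {ω γ κ : ℝ} {ψ₀ : Param p}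
  {T : Set (Cov p × ℝ)} {Ψ : Set (Param p)}

theorem IsEstimate.isMaxOn_empiricalMean {m : ℕ} {z : ℕ → Obs p} {ψ : Param p}
    (h : IsEstimate Ψ γ m (fun i => (z i).1) (fun i => (z i).2.1) (fun i => (z i).2.2) ψ) :
    IsMaxOn (fun ψ => empiricalMean m z fun w => gammaLik γ w.1 w.2.1 w.2.2 ψ) Ψ ψ :=
  isMaxOn_iff.2 fun _ hψ => mul_le_mul_of_nonneg_left (h.2 hψ) (inv_nonneg.2 m.cast_nonneg)

theorem eventuallyFar_empiricalMean_varTerm_lt (hT : IsCompact T) (hTpos : ∀ z ∈ T, 0 < z.2)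
    (hνT : ∀ᵐ z ∂ν, z ∈ T) (hdet : (Matrix.of fun j k => ∫ z, z.1 j * z.1 k ∂ν).det ≠ 0)
    (hΨ : IsCompact Ψ) (hΨpos : ∀ ψ ∈ Ψ, 0 < ψ.2) (hψ₀ : ψ₀ ∈ Ψ)
    (hω : ω ∈ Set.Ico (0 : ℝ) 1) (hγ : 0 < γ) (hκ : 0 < κ) :
    EventuallyFar ν ω ψ₀ fun m z => ∀ ψ,
      IsEstimate Ψ γ m (fun i => (z i).1) (fun i => (z i).2.1) (fun i => (z i).2.2) ψ →
        empiricalMean m z (fun w => varTerm γ w.1 w.2.1 w.2.2 ψ) <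
          (1 - ω) * Q ν ψ₀ γ ψ₀ + κ := by
  have hA := hΨpos _ hψ₀
  have hν := hνT.mono hTpos
  have hsnd := measurePreserving_snd_coreLaw (ψ₀ := ψ₀) hν hA.le
  have := hsnd.hasLaw.isProbabilityMeasure
  have hcoreT : ∀ᵐ w ∂coreLaw ν ψ₀, w.2 ∈ T := hsnd.quasiMeasurePreserving.ae hνT
  have hlik := hasDecay_gammaLik hT hTpos hΨ hΨpos hγ
  have hvar := hasDecay_varTerm hT hTpos hΨ hΨpos hγ
  have hTm := hT.measurableSet
  have hx : MemLp Prod.fst 2 ν := by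
    obtain ⟨C, hC⟩ := hT.exists_bound_of_continuousOn (f := Prod.fst) (by fun_prop)
    exact .of_bound (by fun_prop) C (hνT.mono hC)
  have hQ : Q ν ψ₀ γ ψ₀ = ∫ w, varTerm γ w.1 w.2.1 w.2.2 ψ₀ ∂coreLaw ν ψ₀ :=
    (integral_coreLaw hν hA.le (hvar.integrable hTm hcoreT hψ₀)).symm
  obtain ⟨η, hη, hstable⟩ := exists_forall_isMaxOn_lt hΨ
    ((hlik.continuousOn_integral hTm hcoreT).const_mul (1 - ω))
    ((hvar.continuousOn_integral hTm hcoreT).const_mul (1 - ω)) hψ₀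
    (fun ψ hψ hne => mul_lt_mul_of_pos_left (integral_gammaLik_lt hν hx hdet hγ (hΨpos ψ hψ) hA hne
      (hlik.integrable hTm hcoreT hψ) (hlik.integrable hTm hcoreT hψ₀)) (sub_pos.2 hω.2)) hκ
  have hω' : ω ∈ Set.Icc (0 : ℝ) 1 := Set.Ico_subset_Icc_self hω
  refine ((hlik.eventuallyFar_abs_empiricalMean_sub_le hTm hTpos hνT hΨ hA hω' hη).and
    (hvar.eventuallyFar_abs_empiricalMean_sub_le hTm hTpos hνT hΨ hA hω' hη)).mono
      fun m z hz ψ hψ => ?_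
  rw [hQ]
  exact hstable _ _ hz.1 hz.2 ψ hψ.1 hψ.isMaxOn_empiricalMean

theorem eventuallyFar_lt_empiricalMean_varTerm_zero (hT : IsCompact T) (hTpos : ∀ z ∈ T, 0 < z.2)
    (hνT : ∀ᵐ z ∂ν, z ∈ T) (hA : 0 < ψ₀.2) (hω : ω ∈ Set.Icc (0 : ℝ) 1) (hκ : 0 < κ) :
    EventuallyFar ν ω ψ₀ fun m z =>
      Q ν ψ₀ 0 ψ₀ - κ < empiricalMean m z (fun w => varTerm 0 w.1 w.2.1 w.2.2 ψ₀) := by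
  refine ⟨1, one_pos, fun δ hδ _ Ω _ P Z hZ => ?_⟩
  have hν := hνT.mono hTpos
  let f (z : Cov p × ℝ) : ℝ := -(z.2 ^ 2 / (ψ₀.2 + z.2))
  have hobs := measurePreserving_snd_obsLaw hν hA hδ hω
  have hfν : Integrable f ν := by
    obtain ⟨C, hC⟩ := hT.exists_bound_of_continuousOn (f := f)
      (ContinuousOn.neg <| ContinuousOn.div (by fun_prop) (by fun_prop)
        fun z hz => (add_pos hA (hTpos z hz)).ne')
    exact .of_bound (by fun_prop) C (hνT.mono hC)
  have hQ : Q ν ψ₀ 0 ψ₀ = ∫ w, f w.2 ∂obsLaw ν ω ψ₀ δ := by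
    rw [← integral_map (φ := Prod.snd) (by fun_prop) (by fun_prop), hobs.map_eq]
    refine integral_congr_ae ?_
    filter_upwards [hν] with z hz
    simp [varTerm_zero (add_pos hA hz), f]
  have hZpos := hZ.ae_forall_mem (S := {w : Obs p | 0 < w.2.2}) (by measurability)
    (hobs.quasiMeasurePreserving.ae hν)
  filter_upwards [hZ.ae_tendsto_empiricalMean (hobs.integrable_comp_of_integrable hfν), hZpos]
    with s hs hpos
  rw [Function.comp_def, ← hQ] at hs
  filter_upwards [hs.eventually_const_lt (sub_lt_self _ hκ)] with m hm
  simpa only [empiricalMean, varTerm_zero (add_pos hA (hpos _))] using hm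

theorem eventuallyFar_lt_empiricalMean_varTerm_zero_estimate (hT : IsCompact T)
    (hTpos : ∀ z ∈ T, 0 < z.2) (hνT : ∀ᵐ z ∂ν, z ∈ T) (hΨ : IsCompact Ψ)
    (hΨpos : ∀ ψ ∈ Ψ, 0 < ψ.2) (hψ₀ : ψ₀ ∈ Ψ) (hω : ω ∈ Set.Ioc (0 : ℝ) 1) (hκ : 0 < κ) :
    EventuallyFar ν ω ψ₀ fun m z => ∀ ψ,
      IsEstimate Ψ 0 m (fun i => (z i).1) (fun i => (z i).2.1) (fun i => (z i).2.2) ψ →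
        Q ν ψ₀ 0 ψ₀ - κ < empiricalMean m z (fun w => varTerm 0 w.1 w.2.1 w.2.2 ψ) := by
  have hA := hΨpos _ hψ₀
  have hω' : ω ∈ Set.Icc (0 : ℝ) 1 := Set.Ioc_subset_Icc_self hω
  obtain ⟨R, hR⟩ := exists_sub_lt_of_isEstimate_zero hT hTpos hΨ hΨpos hψ₀ (half_pos hκ)
  refine (((eventuallyFar_forall_mem hT.measurableSet hTpos hνT hA hω').and
    (eventuallyFar_lt_empiricalMean_sq (hνT.mono hTpos) hA hω R)).and
      (eventuallyFar_lt_empiricalMean_varTerm_zero hT hTpos hνT hA hω' (half_pos hκ))).mono ?_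
  rintro m z ⟨⟨hzT, hsq⟩, hQ⟩ ψ hψ
  have hle := empiricalMean_le_add (f := fun w : Obs p => varTerm 0 w.1 w.2.1 w.2.2 ψ₀)
    (g := fun w => varTerm 0 w.1 w.2.1 w.2.2 ψ) (m := m) (half_pos hκ).le fun i =>
    varTerm_zero_le_add hA (hΨpos ψ hψ.1) (hTpos _ (hzT i)) (half_pos hκ).le
      (hR m z hzT hsq ψ hψ).le (z i).1 (z i).2.1
  linarith

theorem eventuallyFar_empiricalMean_varTerm_lt_varTerm_zero (hT : IsCompact T)
    (hTpos : ∀ z ∈ T, 0 < z.2) (hνT : ∀ᵐ z ∂ν, z ∈ T)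
    (hdet : (Matrix.of fun j k => ∫ z, z.1 j * z.1 k ∂ν).det ≠ 0)
    (hΨ : IsCompact Ψ) (hΨpos : ∀ ψ ∈ Ψ, 0 < ψ.2) (hψ₀ : ψ₀ ∈ Ψ)
    (hω : ω ∈ Set.Ioo (0 : ℝ) 1) (hγ : 0 < γ)
    (hQ : (1 - ω) * Q ν ψ₀ γ ψ₀ < Q ν ψ₀ 0 ψ₀) :
    EventuallyFar ν ω ψ₀ fun m z => ∀ ψ ψ',
      IsEstimate Ψ γ m (fun i => (z i).1) (fun i => (z i).2.1) (fun i => (z i).2.2) ψ →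
      IsEstimate Ψ 0 m (fun i => (z i).1) (fun i => (z i).2.1) (fun i => (z i).2.2) ψ' →
        empiricalMean m z (fun w => varTerm γ w.1 w.2.1 w.2.2 ψ) <
          empiricalMean m z (fun w => varTerm 0 w.1 w.2.1 w.2.2 ψ') := by
  have hgap := half_pos (sub_pos.2 hQ)
  refine ((eventuallyFar_empiricalMean_varTerm_lt hT hTpos hνT hdet hΨ hΨpos hψ₀
    (Set.Ioo_subset_Ico_self hω) hγ hgap).and
      (eventuallyFar_lt_empiricalMean_varTerm_zero_estimate hT hTpos hνT hΨ hΨpos hψ₀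
        (Set.Ioo_subset_Ioc_self hω) hgap)).mono fun m z h ψ ψ' hψ hψ' => ?_
  linarith [h.1 ψ hψ, h.2 ψ' hψ']

theorem IsSelected.empiricalMean_varTerm_le {Γ : Finset ℝ} {m : ℕ} {z : ℕ → Obs p}
    {ψhat : ℝ → Param p} {γop : ℝ} (h : IsSelected Γ m (fun i => (z i).1) (fun i => (z i).2.1)
      (fun i => (z i).2.2) ψhat γop) (hγ : γ ∈ Γ) :
    empiricalMean m z (fun w => varTerm γop w.1 w.2.1 w.2.2 (ψhat γop)) ≤
      empiricalMean m z (fun w => varTerm γ w.1 w.2.1 w.2.2 (ψhat γ)) := by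
  have hmin := h.2 hγ
  simp only [Set.mem_ofPred_eq, robustVar, Finset.sum_add_distrib, add_le_add_iff_left] at hmin
  exact mul_le_mul_of_nonneg_left hmin (inv_nonneg.2 m.cast_nonneg)

end Selection

theorem tendsto_measure_setOf_of_ae_eventually {Ω : Type*} [MeasurableSpace Ω] {P : Measure Ω}
    [IsProbabilityMeasure P] {q : ℕ → Ω → Prop} (h : ∀ᵐ s ∂P, ∀ᶠ m in atTop, q m s) :
    Tendsto (fun m => P {s | q m s}) atTop (𝓝 1) := by
  set S : ℕ → Set Ω := fun n => {s | ∀ m, n ≤ m → q m s}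
  have hmono : Monotone S := fun a b hab s hs m hm => hs m (hab.trans hm)
  have hunion : P (⋃ n, S n) = 1 := by
    rw [← measure_univ (μ := P)]
    refine measure_congr (eventuallyEq_univ.2 ?_)
    filter_upwards [h] with s hs
    obtain ⟨n, hn⟩ := eventually_atTop.1 hs
    exact Set.mem_iUnion.2 ⟨n, hn⟩
  have hlim := tendsto_measure_iUnion_atTop (μ := P) hmono
  rw [hunion] at hlim
  exact tendsto_of_tendsto_of_tendsto_of_le_of_le hlim tendsto_const_nhds
    (fun n => measure_mono fun s hs => hs n le_rfl) fun n => prob_le_one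

end RobustFayHerriot

open RobustFayHerriot

theorem theorem3_general {p : ℕ} (ν : Measure (Cov p × ℝ)) [IsProbabilityMeasure ν]
    (X : Set (Cov p)) (DL DU : ℝ) (Ψ : Set (Param p)) (ψstar : Param p) (Γ : Finset ℝ)
    (ω γstar : ℝ) (hDL : 0 < DL) (hD : ∀ᵐ z ∂ν, z.2 ∈ Set.Icc DL DU)
    (hX : Bornology.IsBounded X) (hxX : ∀ᵐ z ∂ν, z.1 ∈ X)
    (hxx : (Matrix.of fun j k : Fin p => ∫ z, z.1 j * z.1 k ∂ν).det ≠ 0)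
    (hΨ : IsCompact Ψ) (hΨpos : ∀ ψ ∈ Ψ, 0 < ψ.2) (hψstar : ψstar ∈ Ψ)
    (hΓ0 : 0 ∈ Γ) (hΓ : ∀ γ ∈ Γ, 0 ≤ γ) (hω : ω ∈ Set.Ioo (0 : ℝ) 1)
    (hγstar : γstar ∈ Γ) (hγstar0 : γstar ≠ 0)
    (hQ : Q ν ψstar 0 ψstar > (1 - ω) * Q ν ψstar γstar ψstar) :
    ∃ ρ₀ : ℝ, 0 < ρ₀ ∧ ∀ δ : ℝ → ℝ, IsProbDensity δ →
      rho X DL DU ψstar γstar δ ≤ ENNReal.ofReal ρ₀ →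
      ∀ (Ω : Type*) [MeasurableSpace Ω] (P : Measure Ω) [IsProbabilityMeasure P]
        (x : ℕ → Ω → Cov p) (D y : ℕ → Ω → ℝ) (ψhat : ℕ → ℝ → Ω → Param p) (γop : ℕ → Ω → ℝ),
        iIndepFun (fun i s => (y i s, x i s, D i s)) P →
        (∀ i, HasLaw (fun s => (y i s, x i s, D i s)) (obsLaw ν ω ψstar δ) P) →
        (∀ m, ∀ᵐ s ∂P, ∀ γ ∈ Γ,
          IsEstimate Ψ γ m (fun i => y i s) (fun i => x i s) (fun i => D i s) (ψhat m γ s)) →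
        (∀ m, ∀ᵐ s ∂P, IsSelected Γ m (fun i => y i s) (fun i => x i s) (fun i => D i s)
          (fun γ => ψhat m γ s) (γop m s)) →
        Tendsto (fun m => P {s | 0 < γop m s}) atTop (𝓝 1) := by
  have hγpos : 0 < γstar := (hΓ _ hγstar).lt_of_ne' hγstar0
  obtain ⟨e, he, hfar⟩ := eventuallyFar_empiricalMean_varTerm_lt_varTerm_zero
    (hX.isCompact_closure.prod isCompact_Icc) (fun z hz => hDL.trans_le hz.2.1)
    (hxX.mp (hD.mono fun z hzD hzX => ⟨subset_closure hzX, hzD⟩)) hxx hΨ hΨpos hψstar hω hγpos hQ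
  obtain ⟨ρ₀, hρ₀, hmass⟩ :=
    exists_centralMass_le_of_rho_le (γ := γstar) hDL hD hX hxX (hΨpos _ hψstar).le he
  refine ⟨ρ₀, hρ₀, fun δ hδ hρ Ω _ P _ x D y ψhat γop hindep hlaw hest hsel => ?_⟩
  apply tendsto_measure_setOf_of_ae_eventually
  filter_upwards [hfar δ hδ (hmass δ hδ hρ) Ω P _ ⟨hindep, hlaw⟩, ae_all_iff.2 hest,
    ae_all_iff.2 hsel] with s hlt hest hsel
  filter_upwards [hlt] with m hm
  refine (hΓ _ (hsel m).1).lt_of_ne' fun hzero => ?_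
  have hle := (hsel m).empiricalMean_varTerm_le (z := fun i => (y i s, x i s, D i s)) hγstar
  rw [hzero] at hle
  exact (hm _ _ (hest m γstar hγstar) (hest m 0 hΓ0)).not_ge hle

theorem theorem3 {p : ℕ} [NeZero p]
    -- the law of `(x_i, D_i)`, the covariate range, the parameter space and the candidate set
    (ν : Measure (RobustFayHerriot.Cov p × ℝ)) [IsProbabilityMeasure ν]
    (X : Set (RobustFayHerriot.Cov p)) (DL DU : ℝ)
    (Ψ : Set (RobustFayHerriot.Param p)) (ψstar : RobustFayHerriot.Param p)
    (Γ : Finset ℝ) (ω γstar : ℝ)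
    -- bounded sampling variances
    (hDL : 0 < DL) (hD : ∀ᵐ z ∂ν, z.2 ∈ Set.Icc DL DU)
    -- bounded covariates with positive-definite second moment matrix
    (hX : Bornology.IsBounded X) (hxX : ∀ᵐ z ∂ν, z.1 ∈ X)
    (hxx : (Matrix.of fun j k : Fin p => ∫ z, z.1 j * z.1 k ∂ν).PosDef)
    -- compact parameter space containing the true parameter
    (hΨ : IsCompact Ψ) (hΨpos : ∀ ψ ∈ Ψ, 0 < ψ.2) (hψstar : ψstar ∈ Ψ)
    -- the first covariate is the constant term
    (hconst : ∀ᵐ z ∂ν, z.1 0 = 1)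
    (hns : ∀ a : ℝ, 0 < a →
      (Matrix.of fun j k : Fin p => ∫ z, z.1 j * z.1 k / (a + z.2) ∂ν).det ≠ 0)
    -- the candidate set satisfies `{0, 1} ⊆ Γ ⊆ [0, 1]`
    (hΓ0 : 0 ∈ Γ) (hΓ1 : 1 ∈ Γ) (hΓ : ∀ γ ∈ Γ, γ ∈ Set.Icc (0 : ℝ) 1)
    (hω : ω ∈ Set.Ioo (0 : ℝ) (1 / 2))
    (hγstar : γstar ∈ Γ) (hγstar0 : γstar ≠ 0)
    (hQ : RobustFayHerriot.Q ν ψstar 0 ψstar >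
      (1 - ω) * RobustFayHerriot.Q ν ψstar γstar ψstar) :
    ∃ ρ₀ : ℝ, 0 < ρ₀ ∧
      ∀ δ : ℝ → ℝ, RobustFayHerriot.IsProbDensity δ →
        -- finite mean and variance of the contamination distribution
        Integrable (fun θ => θ * δ θ) →
        Integrable (fun θ => (θ - RobustFayHerriot.densityMean δ) ^ 2 * δ θ) →
        -- `E[(xᵀβ⋆ - μ_δ)² | D] ≥ A⋆ + D_U` almost surely
        (∀ᵐ z ∂ν, ψstar.2 + DU ≤
          (ν[fun z => (inner ℝ z.1 ψstar.1 - RobustFayHerriot.densityMean δ) ^ 2 |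
            MeasurableSpace.comap Prod.snd inferInstance]) z) →
        -- regularity conditions (a)-(e)
        (∃ ψdag, RobustFayHerriot.ScoreRegularity
          (RobustFayHerriot.obsLaw ν ω ψstar δ) X DL DU Ψ γstar ψdag) →
        -- `ρ` is sufficiently small
        RobustFayHerriot.rho X DL DU ψstar γstar δ ≤ ENNReal.ofReal ρ₀ →
        ∀ (Ω : Type*) [MeasurableSpace Ω] (P : Measure Ω) [IsProbabilityMeasure P]
          (x : ℕ → Ω → RobustFayHerriot.Cov p) (D θ y : ℕ → Ω → ℝ)
          (ψhat : ℕ → ℝ → Ω → RobustFayHerriot.Param p) (γop : ℕ → Ω → ℝ),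
          -- i.i.d. observations from the contaminated two-stage model
          iIndepFun (fun i s => (y i s, x i s, D i s)) P →
          (∀ i, HasLaw (fun s => ((x i s, D i s), (θ i s, y i s)))
            (RobustFayHerriot.jointLaw ν ω ψstar δ) P) →
          -- the estimates of `ψ` and the selected tuning parameter
          (∀ m, ∀ᵐ s ∂P, ∀ γ ∈ Γ, RobustFayHerriot.IsEstimate Ψ γ m
            (fun i => y i s) (fun i => x i s) (fun i => D i s) (ψhat m γ s)) →
          (∀ m, ∀ᵐ s ∂P, RobustFayHerriot.IsSelected Γ m
            (fun i => y i s) (fun i => x i s) (fun i => D i s) (fun γ => ψhat m γ s)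
            (γop m s)) →
          Tendsto (fun m => P {s | 0 < γop m s}) atTop (𝓝 1) :=
  let ⟨ρ₀, hρ₀, h⟩ := theorem3_general ν X DL DU Ψ ψstar Γ ω γstar hDL hD hX hxX hxx.det_pos.ne'
    hΨ hΨpos hψstar hΓ0 (fun γ hγ => (hΓ γ hγ).1) ⟨hω.1, by linarith [hω.2]⟩ hγstar hγstar0 hQ
  ⟨ρ₀, hρ₀, fun δ hδ _ _ _ _ hρ Ω _ P _ x D _ y ψhat γop hindep hlaw =>
    h δ hδ hρ Ω P x D y ψhat γop hindep fun i => hasLaw_obs (hlaw i)⟩
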